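/- **Setting.** Let $\mathcal X\subseteq\mathbb R^d$ be non-empty and $K\ge 2$. A *policy* is a measurable $\pi:[K]\times\mathcal X\to[0,1]$ with $\sum_a\pi(a\mid x)=1$ for all $x$; a *policy class* $\Pi$ is a set of policies. A finite set $F\subseteq\mathcal X$ is *shattered* by $\Pi$ if there are $f_1,f_{-1}:F\to[K]$ with $f_1(s)\ne f_{-1}(s)$ for all $s\in F$ such that for every $\epsilon\in\{\pm1\}^F$ some $\pi\in\Pi$ recommends, at each $s\in F$, the arm $f_{\epsilon_s}(s)$ with probability one. The *Natarajan dimension* $d_{\mathrm N}(\Pi)$ is the maximal cardinality of a shattered set. For a probability measure $\zeta$ on $\mathcal X$ and measurable $\sigma^a:\mathcal X\to(0,\infty)$, $a\in[K]$, let $\mathcal P_\zeta$ be the set of Borel probability distributions $P$ of $(X,Y^1,\dots,Y^K)\in\mathcal X\times\mathbb R^K$ with $X\sim\zeta$, integrable $Y^a$ and conditional means $\mu^a(P)(x)=\mathbb E_P[Y^a\mid X=x]$, such that for every $a$ and $\zeta$-almost every $x$, $\mathrm{Var}_P(Y^a\mid X=x)=(\sigma^a(x))^2$ and $Y^a-\mu^a(P)(x)$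 is subgaussian given $X=x$. For a budget $T$, independent copies $(X_t,Y^1_t,\dots,Y^K_t)$, $t\le T$, are drawn from $P$. A *strategy with policy class $\Pi$* chooses in round $t$ an arm $A_t$ from the past observations $(X_s,A_s,Y^{A_s}_s)_{s<t}$ and $X_t$ (possibly with external randomization), and after round $T$ a policy $\widehat\pi_T\in\Pi$ from all observations (and the randomization); $\widehat a_T(x)$ is then drawn from $\widehat\pi_T(\cdot\mid x)$. It is *null consistent* (over $\mathcal P_\zeta$) if for every $P\in\mathcal P_\zeta$ and $\zeta$-almost every $x$: if $\mu^1(P)(x)=\dots=\mu^K(P)(x)$, then $|\mathbb P_P(\widehat a_T(x)=a)-\mathbb P_P(\widehat a_T(x)=b)|\to0$ as $T\to\infty$ for all $a,b\in[K]$. The simple regret is $R(P)(\widehat\pi_T)=\sup_{\pi\in\Pi}Q(P)(\pi)-Q(P)(\widehat\pi_T)$, where $Q(P)(\pi)=\mathbb E_{X\sim\zeta}\big[\sum_a\pi(a\mid X)\mu^a(P)(X)\big]$. **Theorem.** Let $K\ge2$ and let $\Pi$ be a policy class with $d_{\mathrm N}(\Pi)=M<\infty$. Suppose that, on each finite set $F$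 shattered by $\Pi$, every $\pi\in\Pi$ coincides with a convex combination of policies in $\Pi$ that are deterministic on $F$ (this holds automatically if all policies in $\Pi$ are deterministic, or if $K=2$). Then there is a probability distribution $\zeta$ on $\mathcal X$ such that, for all measurable $\sigma^1,\dots,\sigma^K:\mathcal X\to(0,\infty)$, the expectation on the right below is finite and every null consistent strategy with policy class $\Pi$ satisfies $$\sup_{P\in\mathcal P_\zeta}\sqrt T\,\mathbb E_P\big[R(P)(\widehat\pi_T)\big]\ \ge\ \frac18\,\mathbb E_{X\sim\zeta}\Big[\sqrt{M\textstyle\sum_{a\in[K]}(\sigma^a(X))^2}\Big]+o(1)\qquad(T\to\infty).$$ -/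

import Mathlib

open MeasureTheory ProbabilityTheory Filter Topology

noncomputable section

/-! ## Policies and the Natarajan dimension -/

/-- A (possibly stochastic) policy: `π x a` is the probability of recommending arm `a` in
context `x`. -/
structure IsPolicy {C : Type*} [MeasurableSpace C] {K : ℕ} (π : C → Fin K → ℝ) : Prop where
  measurable : ∀ a, Measurable fun x => π x a
  nonneg : ∀ x a, 0 ≤ π x a
  sum_eq_one : ∀ x, ∑ a, π x a = 1

/-- `π` recommends arm `a` in context `x` with probability one. -/
def Recommends {C : Type*} {K : ℕ} (π : C → Fin K → ℝ) (x : C) (a : Fin K) : Prop :=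
  π x = Pi.single a 1

/-- The class `Pol` shatters the finite set `F`: there are labellings `f₁, f₂` differing at each
point of `F`, such that for every choice of signs `b` some policy of the class recommends,
at each `s ∈ F`, the arm `f₁ s` or `f₂ s` according to the sign `b s`. -/
def Shatters {C : Type*} {K : ℕ} (Pol : Set (C → Fin K → ℝ)) (F : Finset C) : Prop :=
  ∃ f₁ f₂ : C → Fin K, (∀ s ∈ F, f₂ s ≠ f₁ s) ∧
    ∀ b : C → Bool, ∃ π ∈ Pol, ∀ s ∈ F, Recommends π s (if b s then f₁ s else f₂ s)

/-- `M` is the Natarajan dimension of `Pol`: the largest cardinality of a shattered set. -/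
def HasNatarajanDim {C : Type*} {K : ℕ} (Pol : Set (C → Fin K → ℝ)) (M : ℕ) : Prop :=
  IsGreatest {m : ℕ | ∃ F : Finset C, F.card = m ∧ Shatters Pol F} M

/-- On the finite set `F`, every policy of the class coincides with a convex combination of
policies of the class that are deterministic on `F`. -/
def DeterministicallyGenerated {C : Type*} {K : ℕ} (Pol : Set (C → Fin K → ℝ))
    (F : Finset C) : Prop :=
  ∀ π ∈ Pol, (fun s : F => π s) ∈ convexHull ℝ
    ((fun (π' : C → Fin K → ℝ) (s : F) => π' s) ''
      {π' | π' ∈ Pol ∧ ∀ s ∈ F, ∃ a, Recommends π' s a})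

/-! ## The location-shift bandit model -/

/-- Full data of one experimental unit: the context and the vector of potential outcomes. -/
abbrev UnitData (C : Type*) (K : ℕ) := C × (Fin K → ℝ)

/-- The conditional law of the potential outcomes given `X = x` under `P`. -/
def condLaw {C : Type*} [MeasurableSpace C] {K : ℕ} (P : ProbabilityMeasure (UnitData C K))
    (x : C) : Measure (Fin K → ℝ) :=
  (P : Measure (UnitData C K)).condKernel x

/-- The conditional mean `μ^a(P)(x) = E_P[Y^a | X = x]`. -/
def condMean {C : Type*} [MeasurableSpace C] {K : ℕ} (P : ProbabilityMeasure (UnitData C K))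
    (a : Fin K) (x : C) : ℝ :=
  ∫ y, y a ∂(condLaw P x)

/-- The location-shift bandit model with context distribution `ζ` and conditional standard
deviations `σ a x`. Statements about conditional laws given `X = x` are meant for `ζ`-almost
every `x`. -/
structure InModel {C : Type*} [MeasurableSpace C] {K : ℕ} (ζ : ProbabilityMeasure C)
    (σ : Fin K → C → ℝ) (P : ProbabilityMeasure (UnitData C K)) : Prop where
  marginal : (P : Measure (UnitData C K)).fst = ζ
  /-- the outcomes have an expectation under `P` -/
  integrable : ∀ a, Integrable (fun z : UnitData C K => z.2 a) P
  condVariance : ∀ a, ∀ᵐ x ∂(ζ : Measure C),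
    variance (fun y : Fin K → ℝ => y a) (condLaw P x) = σ a x ^ 2
  subgaussian : ∀ a, ∀ᵐ x ∂(ζ : Measure C), ∃ c : NNReal,
    HasSubgaussianMGF (fun y : Fin K → ℝ => y a - condMean P a x) c (condLaw P x)

/-! ## Adaptive experiments -/

/-- What is observed in one round: context, assigned arm, outcome of the assigned arm. -/
abbrev Obs (C : Type*) (K : ℕ) := C × Fin K × ℝ

/-- A strategy for policy class `Pol`, possibly using external randomness `ω ∈ Ω`.
For each budget `T`, `arm T t ω h x` is the arm assigned in round `t` (counted from `0`) when
`h` is the history of the `t` earlier rounds and `x` the current context;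
`policy T ω h` is the policy in `Pol` constructed from the `T` observations. -/
structure Strategy (Ω : Type*) [MeasurableSpace Ω] (C : Type*) [MeasurableSpace C] {K : ℕ}
    (Pol : Set (C → Fin K → ℝ)) where
  arm : (T t : ℕ) → Ω → (Fin t → Obs C K) → C → Fin K
  policy : (T : ℕ) → Ω → (Fin T → Obs C K) → (C → Fin K → ℝ)
  measurable_arm : ∀ T t,
    Measurable fun p : Ω × (Fin t → Obs C K) × C => arm T t p.1 p.2.1 p.2.2
  policy_mem : ∀ T ω h, policy T ω h ∈ Pol
  measurable_policy : ∀ T x a,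
    Measurable fun p : Ω × (Fin T → Obs C K) => policy T p.1 p.2 x a

/-- One more round: the unit `z = (X, Y^1, …, Y^K)` arrives, the arm `A` is chosen from the past
and `X`, and `(X, A, Y^A)` is appended to the history. -/
def Strategy.step {Ω C : Type*} [MeasurableSpace Ω] [MeasurableSpace C] {K : ℕ}
    {Pol : Set (C → Fin K → ℝ)} (S : Strategy Ω C Pol) (T t : ℕ)
    (p : (Ω × (Fin t → Obs C K)) × UnitData C K) : Ω × (Fin (t + 1) → Obs C K) :=
  (p.1.1, Fin.snoc (α := fun _ => Obs C K) p.1.2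
    (p.2.1, S.arm T t p.1.1 p.1.2 p.2.1, p.2.2 (S.arm T t p.1.1 p.1.2 p.2.1)))

/-- Joint law of the external randomness and of the first `t` observations, when the units are
drawn independently from `P` and the strategy is used with budget `T`. -/
def Strategy.historyLaw {Ω C : Type*} [MeasurableSpace Ω] [MeasurableSpace C] {K : ℕ}
    {Pol : Set (C → Fin K → ℝ)} (S : Strategy Ω C Pol) (ν : Measure Ω)
    (P : ProbabilityMeasure (UnitData C K)) (T : ℕ) : (t : ℕ) → Measure (Ω × (Fin t → Obs C K))
  | 0 => ν.map fun ω => (ω, Fin.elim0)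
  | t + 1 => ((S.historyLaw ν P T t).prod (P : Measure (UnitData C K))).map (S.step T t)

/-- The probability, under `P` and with budget `T`, that arm `a` is recommended in context `x`
by an arm drawn from the constructed policy at `x`. -/
def Strategy.recommendProb {Ω C : Type*} [MeasurableSpace Ω] [MeasurableSpace C] {K : ℕ}
    {Pol : Set (C → Fin K → ℝ)} (S : Strategy Ω C Pol) (ν : Measure Ω)
    (P : ProbabilityMeasure (UnitData C K)) (T : ℕ) (x : C) (a : Fin K) : ℝ :=
  ∫ p, S.policy T p.1 p.2 x a ∂(S.historyLaw ν P T T)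

/-- Null consistency over the model: whenever the conditional means of all arms at `x` agree,
the recommendation probabilities at `x` of any two arms become equal in the limit. -/
def Strategy.NullConsistent {Ω C : Type*} [MeasurableSpace Ω] [MeasurableSpace C] {K : ℕ}
    {Pol : Set (C → Fin K → ℝ)} (S : Strategy Ω C Pol) (ν : Measure Ω)
    (ζ : ProbabilityMeasure C) (σ : Fin K → C → ℝ) : Prop :=
  ∀ P : ProbabilityMeasure (UnitData C K), InModel ζ σ P → ∀ᵐ x ∂(ζ : Measure C),
    (∀ a b, condMean P a x = condMean P b x) →
    ∀ a b, Tendsto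
      (fun T : ℕ => |S.recommendProb ν P T x a - S.recommendProb ν P T x b|) atTop (𝓝 0)

/-! ## Regret -/

/-- The value `Q(P)(π)`. -/
def policyValue {C : Type*} [MeasurableSpace C] {K : ℕ} (P : ProbabilityMeasure (UnitData C K))
    (π : C → Fin K → ℝ) : ℝ :=
  ∫ x, ∑ a, π x a * condMean P a x ∂(P : Measure (UnitData C K)).fst

/-- The simple regret of `π` relative to the best value in the class `Pol`. -/
def simpleRegret {C : Type*} [MeasurableSpace C] {K : ℕ} (Pol : Set (C → Fin K → ℝ))
    (P : ProbabilityMeasure (UnitData C K)) (π : C → Fin K → ℝ) : ℝ :=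
  sSup (policyValue P '' Pol) - policyValue P π

/-- The expected simple regret of a strategy with budget `T`. -/
def Strategy.expectedRegret {Ω C : Type*} [MeasurableSpace Ω] [MeasurableSpace C] {K : ℕ}
    {Pol : Set (C → Fin K → ℝ)} (S : Strategy Ω C Pol) (ν : Measure Ω)
    (P : ProbabilityMeasure (UnitData C K)) (T : ℕ) : ℝ :=
  ∫ p, simpleRegret Pol P (S.policy T p.1 p.2) ∂(S.historyLaw ν P T T)

end

/-! The context law is uniform on a shattered set `F` of size M, which turns the problem into M
bandit problems that share the budget T. All experiments have independent Gaussian outcomes, so they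
lie in the model and have explicit likelihood ratios. The proof is a dichotomy on the labellings of
`F` that deterministic policies of the class realize: changing one label either always leads to
another realized labelling, or fails for some realized `g`, point `s` and arm `a`.

If changing a label never fails, all of [K]^F is realized (`realizes_of_update_closed`), and the
bound holds for every strategy and every T ≥ 1, without null consistency. Put V_s = ∑_a σ_a(s)².
Independently at each s, draw an arm a and a sign with probability σ_a(s)²/(2V_s), and let ±d_s be
the mean of a at s, all other means there being 0. Not recommending a good arm, or recommending a
bad one, costs d_s. Compare both signs with the experiment in which all means at s vanish: there the
two error probabilities sum to 1, and each change of measure costs at most the relative entropy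
d_s²/(2σ_a²)·E[N_a(s)] plus 1/8 (`integral_sub_integral_le_neg_integral_log_density`). The weights
cancel the variances, so only ∑_a E[N_a(s)] = T/M remains, whatever the allocation. The average
error is thus at least 3/8 − d_s²T/(2MV_s), and d_s = ½√(MV_s/T) makes this 1/4
(`Strategy.quarter_le_sum_errorProb`). Some point of the prior is at least as bad as the average
(`exists_sum_le_of_resample`).

If changing a label fails, let all means vanish at s and let `g t` be the best arm, with gap 1, at
each other t. Null consistency forces arm a at s with probability tending to 1/K. As the changed
labelling is not realized, a deterministic policy choosing a at s must deviate from `g` elsewhere;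
by convexity this trade-off passes to all policies of the class (`apply_le_sum_deviation`). The
regret then stays of constant order, and √T times it diverges. -/

noncomputable section

open scoped ENNReal NNReal

/-! ## Entropy bound -/

/-- Donsker–Varadhan inequality combined with Hoeffding's lemma, for a likelihood ratio `exp L`. -/
lemma integral_sub_integral_le_neg_integral_log_density {α : Type*} [MeasurableSpace α]
    {μ ν : Measure α} [IsProbabilityMeasure μ] [IsProbabilityMeasure ν] {L f : α → ℝ}
    (hL : Measurable L) (hνμ : ν = μ.withDensity fun x => ENNReal.ofReal (Real.exp (L x)))
    (hLi : Integrable L μ) (hf : Measurable f) (hf1 : ∀ x, f x ∈ Set.Icc (0 : ℝ) 1) :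
    (∫ x, f x ∂μ) - ∫ x, f x ∂ν ≤ -(∫ x, L x ∂μ) + 1 / 8 := by
  have hfi : ∀ (ρ : Measure α) [IsProbabilityMeasure ρ], Integrable f ρ := fun ρ _ =>
    Integrable.of_mem_Icc 0 1 hf.aemeasurable (ae_of_all _ hf1)
  set m := ∫ x, f x ∂ν with hm
  have hsub := hasSubgaussianMGF_of_mem_Icc (μ := ν) hf.aemeasurable (ae_of_all _ hf1)
  have hexpi : Integrable (fun x => Real.exp (f x - m)) ν := by
    simpa using hsub.integrable_exp_mul 1
  -- Hoeffding's lemma on an interval of length 1: variance proxy 1/4, hence log-mgf at most 1/8 at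
  -- the argument 1.
  have hmgf : ∫ x, Real.exp (f x - m) ∂ν ≤ Real.exp (1 / 8) := by
    have := hsub.mgf_le 1
    simp only [mgf, one_mul] at this
    refine this.trans (Real.exp_le_exp.2 ?_)
    norm_num
  clear_value m
  have hdm : Measurable fun x => ENNReal.ofReal (Real.exp (L x)) := by fun_prop
  have hlt : ∀ᵐ x ∂μ, ENNReal.ofReal (Real.exp (L x)) < ∞ := ae_of_all _ fun x => by simp
  have hcomb : ∀ x, (ENNReal.ofReal (Real.exp (L x))).toReal • Real.exp (f x - m)
      = Real.exp (f x - m + L x) := fun x => by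
    rw [ENNReal.toReal_ofReal (Real.exp_pos _).le, smul_eq_mul, mul_comm, Real.exp_add]
  have heq : ∫ x, Real.exp (f x - m) ∂ν = ∫ x, Real.exp (f x - m + L x) ∂μ := by
    rw [hνμ, integral_withDensity_eq_integral_toReal_smul hdm hlt]
    simp_rw [hcomb]
  have hint : Integrable (fun x => Real.exp (f x - m + L x)) μ := by
    rw [hνμ, integrable_withDensity_iff_integrable_smul' hdm hlt] at hexpi
    simp_rw [hcomb] at hexpi
    exact hexpi
  have hgi : Integrable (fun x => f x - m + L x) μ := ((hfi μ).sub (integrable_const _)).add hLi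
  -- Jensen under μ for f − m + L; the factor exp L turns the right-hand side into the ν-integral
  -- bounded by `hmgf`.
  have hjensen := convexOn_exp.map_integral_le (μ := μ) (f := fun x => f x - m + L x)
    Real.continuous_exp.continuousOn isClosed_univ (ae_of_all _ fun _ => Set.mem_univ _) hgi hint
  have h1 : ∫ x, (f x - m + L x) ∂μ ≤ 1 / 8 :=
    Real.exp_le_exp.1 (hjensen.trans (heq ▸ hmgf))
  rw [integral_add (f := fun x => f x - m) ((hfi μ).sub (integrable_const _)) hLi,
    integral_sub (hfi μ) (integrable_const _)] at h1
  simp at h1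
  linarith

/-! ## The history law -/

section History

variable {Ω C : Type*} [MeasurableSpace Ω] [MeasurableSpace C] {K : ℕ}
  {Pol : Set (C → Fin K → ℝ)}

lemma measurable_apply_prod {ι : Type*} [Countable ι] [MeasurableSpace ι]
    [MeasurableSingletonClass ι] {β : Type*} [MeasurableSpace β] :
    Measurable fun p : ι × (ι → β) => p.2 p.1 :=
  measurable_from_prod_countable_right fun i => measurable_pi_apply i

lemma measurable_fin_snoc {β : Type*} [MeasurableSpace β] (t : ℕ) :
    Measurable fun p : (Fin t → β) × β => Fin.snoc (α := fun _ => β) p.1 p.2 := by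
  refine measurable_pi_iff.2 fun i => ?_
  induction i using Fin.lastCases with
  | last => simpa using measurable_snd
  | cast i => simpa using measurable_fst.eval

/-- The observation made in one round when arms are assigned by `A`. -/
def observe (A : C → Fin K) (z : UnitData C K) : Obs C K := (z.1, A z.1, z.2 (A z.1))

lemma measurable_observe {A : C → Fin K} (hA : Measurable A) : Measurable (observe A) :=
  measurable_fst.prodMk ((hA.comp measurable_fst).prodMk
    (measurable_apply_prod.comp ((hA.comp measurable_fst).prodMk measurable_snd)))

lemma Strategy.measurable_arm_history (S : Strategy Ω C Pol) (T t : ℕ)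
    (q : Ω × (Fin t → Obs C K)) : Measurable (S.arm T t q.1 q.2) :=
  (S.measurable_arm T t).comp
    (measurable_const.prodMk (measurable_const.prodMk measurable_id))

lemma Strategy.step_eq (S : Strategy Ω C Pol) (T t : ℕ)
    (q : Ω × (Fin t → Obs C K)) (z : UnitData C K) :
    S.step T t (q, z) = (q.1, Fin.snoc (α := fun _ => Obs C K) q.2
      (observe (S.arm T t q.1 q.2) z)) := rfl

lemma Strategy.measurable_step (S : Strategy Ω C Pol) (T t : ℕ) :
    Measurable (S.step T t) := by
  have harm : Measurable fun p : (Ω × (Fin t → Obs C K)) × UnitData C K =>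
      S.arm T t p.1.1 p.1.2 p.2.1 :=
    (S.measurable_arm T t).comp
      (measurable_fst.fst.prodMk (measurable_fst.snd.prodMk measurable_snd.fst))
  refine measurable_fst.fst.prodMk ((measurable_fin_snoc t).comp
    (measurable_fst.snd.prodMk (measurable_snd.fst.prodMk (harm.prodMk ?_))))
  exact measurable_apply_prod.comp (harm.prodMk measurable_snd.snd)

lemma measurable_prodMk_elim0 {β : Type*} [MeasurableSpace β] :
    Measurable fun ω : Ω => (ω, (Fin.elim0 : Fin 0 → β)) :=
  measurable_id.prodMk measurable_const

instance Strategy.isProbabilityMeasure_historyLaw (S : Strategy Ω C Pol) (ν : Measure Ω)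
    [IsProbabilityMeasure ν] (P : ProbabilityMeasure (UnitData C K)) (T t : ℕ) :
    IsProbabilityMeasure (S.historyLaw ν P T t) := by
  induction t with
  | zero => exact Measure.isProbabilityMeasure_map measurable_prodMk_elim0.aemeasurable
  | succ t ih => exact Measure.isProbabilityMeasure_map (S.measurable_step T t).aemeasurable

lemma Strategy.lintegral_historyLaw_succ (S : Strategy Ω C Pol) (ν : Measure Ω)
    [IsProbabilityMeasure ν] (P : ProbabilityMeasure (UnitData C K)) (T t : ℕ)
    {G : Ω × (Fin (t + 1) → Obs C K) → ℝ≥0∞} (hG : Measurable G) :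
    ∫⁻ p, G p ∂(S.historyLaw ν P T (t + 1)) =
      ∫⁻ q, ∫⁻ z, G (S.step T t (q, z)) ∂(P : Measure (UnitData C K))
        ∂(S.historyLaw ν P T t) := by
  rw [Strategy.historyLaw, lintegral_map hG (S.measurable_step T t),
    lintegral_prod (fun x => G (S.step T t x)) (hG.comp (S.measurable_step T t)).aemeasurable]

/-- If the observation of a single round has likelihood ratio `ℓ`, whatever the assignment rule,
then the history of `t` rounds has as likelihood ratio the product of the `ℓ`. -/
lemma Strategy.historyLaw_eq_withDensity (S : Strategy Ω C Pol) (ν : Measure Ω)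
    [IsProbabilityMeasure ν] (P P' : ProbabilityMeasure (UnitData C K))
    {l : Obs C K → ℝ≥0∞} (hl : Measurable l)
    (hPP' : ∀ A : C → Fin K, Measurable A → ∀ G : Obs C K → ℝ≥0∞, Measurable G →
      ∫⁻ z, G (observe A z) ∂(P' : Measure (UnitData C K)) =
        ∫⁻ z, l (observe A z) * G (observe A z) ∂(P : Measure (UnitData C K)))
    (T t : ℕ) :
    S.historyLaw ν P' T t =
      (S.historyLaw ν P T t).withDensity fun p => ∏ i, l (p.2 i) := by
  have hprod : ∀ t : ℕ, Measurable fun p : Ω × (Fin t → Obs C K) => ∏ i, l (p.2 i) := by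
    intro t
    fun_prop
  induction t with
  | zero => simp [Strategy.historyLaw]
  | succ t ih =>
    refine Measure.ext_of_lintegral _ fun G hG => ?_
    rw [S.lintegral_historyLaw_succ ν P' T t hG,
      lintegral_withDensity_eq_lintegral_mul _ (hprod _) hG,
      S.lintegral_historyLaw_succ ν P T t ((hprod _).mul hG), ih,
      lintegral_withDensity_eq_lintegral_mul _ (hprod _)
        (Measurable.lintegral_prod_right' (f := fun x => G (S.step T t x)) (hG.comp (S.measurable_step T t)))]
    refine lintegral_congr fun q => ?_
    have hA := S.measurable_arm_history T t q
    have hG' : Measurable fun o : Obs C K =>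
        G (q.1, Fin.snoc (α := fun _ => Obs C K) q.2 o) :=
      hG.comp (measurable_const.prodMk
        ((measurable_fin_snoc t).comp (measurable_const.prodMk measurable_id)))
    simp only [Pi.mul_apply, S.step_eq]
    have hmul := lintegral_const_mul (μ := (P : Measure (UnitData C K)))
      (∏ i, l (q.2 i)) ((hl.mul hG').comp (measurable_observe hA))
    simp only [Function.comp_apply, Pi.mul_apply] at hmul
    -- Given the past `q`, the assignment rule is a fixed measurable map of the context, so the
    -- one-round identity applies.
    rw [hPP' _ hA _ hG', ← hmul]
    refine lintegral_congr fun z => ?_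
    simp [Fin.prod_univ_castSucc, mul_assoc]

/-- If each round contributes `c` in expectation, whatever the assignment rule, then `t` rounds
contribute `t * c`. -/
lemma Strategy.integral_sum_historyLaw (S : Strategy Ω C Pol) (ν : Measure Ω)
    [IsProbabilityMeasure ν] (P : ProbabilityMeasure (UnitData C K))
    {φ : Obs C K → ℝ} (hφ : Measurable φ)
    (hi : ∀ b, Integrable (fun z : UnitData C K => φ (z.1, b, z.2 b)) P) {c : ℝ}
    (hc : ∀ A : C → Fin K, Measurable A →
      ∫ z, φ (observe A z) ∂(P : Measure (UnitData C K)) = c) (T t : ℕ) :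
    Integrable (fun p => ∑ i, φ (p.2 i)) (S.historyLaw ν P T t) ∧
      ∫ p, ∑ i, φ (p.2 i) ∂(S.historyLaw ν P T t) = t * c := by
  have hsum : ∀ t : ℕ, Measurable fun p : Ω × (Fin t → Obs C K) => ∑ i, φ (p.2 i) := by
    intro t
    fun_prop
  induction t with
  | zero => simp
  | succ t ih =>
    obtain ⟨ih1, ih2⟩ := ih
    set H := S.historyLaw ν P T t with hH
    have hstep : ∀ x : (Ω × (Fin t → Obs C K)) × UnitData C K,
        ∑ i, φ ((S.step T t x).2 i) =
          ∑ i, φ (x.1.2 i) + φ (observe (S.arm T t x.1.1 x.1.2) x.2) := by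
      rintro ⟨q, z⟩
      simp [S.step_eq, Fin.sum_univ_castSucc]
    have hfst : Integrable (fun x : (Ω × (Fin t → Obs C K)) × UnitData C K =>
        ∑ i, φ (x.1.2 i)) (H.prod (P : Measure (UnitData C K))) :=
      ih1.comp_fst (P : Measure (UnitData C K))
    have hobs : Measurable fun x : (Ω × (Fin t → Obs C K)) × UnitData C K =>
        observe (S.arm T t x.1.1 x.1.2) x.2 := by
      have := (measurable_pi_apply (Fin.last t)).comp (S.measurable_step T t).snd
      simpa [Function.comp_def, Strategy.step, observe] using this
    -- The assigned arm varies with the history; summing over all arms gives a dominating function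
    -- of the new unit alone.
    have hdom : Integrable (fun z : UnitData C K => ∑ b, ‖φ (z.1, b, z.2 b)‖)
        (P : Measure (UnitData C K)) := integrable_finsetSum _ fun b _ => (hi b).norm
    have hsnd : Integrable (fun x : (Ω × (Fin t → Obs C K)) × UnitData C K =>
        φ (observe (S.arm T t x.1.1 x.1.2) x.2)) (H.prod (P : Measure (UnitData C K))) := by
      refine (hdom.comp_snd H).mono' (hφ.comp hobs).aestronglyMeasurable (ae_of_all _ ?_)
      rintro ⟨q, z⟩
      exact Finset.single_le_sum (f := fun b => ‖φ (z.1, b, z.2 b)‖)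
        (fun b _ => norm_nonneg _) (Finset.mem_univ (S.arm T t q.1 q.2 z.1))
    constructor
    · rw [Strategy.historyLaw, integrable_map_measure (hsum _).aestronglyMeasurable
        (S.measurable_step T t).aemeasurable]
      exact (hfst.add hsnd).congr (ae_of_all _ fun x => (hstep x).symm)
    · rw [Strategy.historyLaw, integral_map (S.measurable_step T t).aemeasurable
        (hsum _).aestronglyMeasurable]
      simp_rw [hstep]
      rw [integral_add hfst hsnd, integral_prod _ hfst, integral_prod _ hsnd]
      simp_rw [fun q : Ω × (Fin t → Obs C K) => hc _ (S.measurable_arm_history T t q)]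
      simp [ih2]
      ring

end History

/-! ## Gaussian location-shift experiments -/

section Gaussian

/-- Exponential tilting of a centred Gaussian. -/
lemma gaussianReal_eq_withDensity_zero (d : ℝ) {v : ℝ≥0} (hv : v ≠ 0) :
    gaussianReal d v = (gaussianReal 0 v).withDensity
      fun y => ENNReal.ofReal (Real.exp ((d * y - d ^ 2 / 2) / v)) := by
  have hm : Measurable fun y : ℝ => ENNReal.ofReal (Real.exp ((d * y - d ^ 2 / 2) / v)) := by
    fun_prop
  rw [gaussianReal_of_var_ne_zero _ hv, gaussianReal_of_var_ne_zero _ hv,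
    ← withDensity_mul _ (measurable_gaussianPDF _ _) hm]
  congr 1
  ext y
  simp only [gaussianPDF, Pi.mul_apply]
  rw [← ENNReal.ofReal_mul (gaussianPDFReal_nonneg _ _ _)]
  congr 1
  simp only [gaussianPDFReal]
  rw [mul_assoc _ (Real.exp _), ← Real.exp_add]
  congr 2
  have : (v : ℝ) ≠ 0 := by exact_mod_cast hv
  field_simp
  ring

variable {C : Type*} {K : ℕ}

/-- Standard Gaussian noise for all arms. -/
abbrev gaussianNoise (K : ℕ) : Measure (Fin K → ℝ) := Measure.pi fun _ => gaussianReal 0 1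

/-- The outcomes in context `x` with means `θ x`, standard deviations `σ · x` and noise `z`. -/
def locationScale (σ : Fin K → C → ℝ) (θ : C → Fin K → ℝ) (x : C) (z : Fin K → ℝ) :
    Fin K → ℝ := fun a => θ x a + σ a x * z a

lemma measurable_locationScale_apply {σ : Fin K → C → ℝ} {θ : C → Fin K → ℝ} (x : C) :
    Measurable (locationScale σ θ x) :=
  measurable_pi_iff.2 fun a => by unfold locationScale; fun_prop

lemma map_eval_locationScale {σ : Fin K → C → ℝ} {θ : C → Fin K → ℝ} (x : C) (a : Fin K) :
    ((gaussianNoise K).map (locationScale σ θ x)).map (fun y => y a) =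
      gaussianReal (θ x a) (Real.toNNReal (σ a x ^ 2)) := by
  have h : (fun y : Fin K → ℝ => y a) ∘ locationScale σ θ x =
      (fun r => θ x a + r) ∘ (fun r => σ a x * r) ∘ Function.eval a := rfl
  rw [Measure.map_map (measurable_pi_apply a) (measurable_locationScale_apply x), h,
    ← Measure.map_map (by fun_prop) (by fun_prop), ← Measure.map_map (by fun_prop) (by fun_prop),
    (measurePreserving_eval (fun _ => gaussianReal 0 1) a).map_eq, gaussianReal_map_const_mul,
    gaussianReal_map_const_add]
  congr 1
  · simp
  · ext
    simp [sq_nonneg]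

variable [MeasurableSpace C]

lemma measurable_locationScale {σ : Fin K → C → ℝ} (hσ : ∀ a, Measurable (σ a))
    {θ : C → Fin K → ℝ} (hθ : Measurable θ) :
    Measurable fun p : C × (Fin K → ℝ) => locationScale σ θ p.1 p.2 := by
  unfold locationScale
  fun_prop

/-- The distribution of a unit with context distribution `ζ` and independent Gaussian outcomes
with means `θ` and standard deviations `σ`. -/
def gaussianUnitLaw (ζ : ProbabilityMeasure C) {σ : Fin K → C → ℝ} (hσ : ∀ a, Measurable (σ a))
    {θ : C → Fin K → ℝ} (hθ : Measurable θ) : ProbabilityMeasure (UnitData C K) :=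
  ⟨((ζ : Measure C).prod (gaussianNoise K)).map fun p => (p.1, locationScale σ θ p.1 p.2),
    Measure.isProbabilityMeasure_map
      (measurable_fst.prodMk (measurable_locationScale hσ hθ)).aemeasurable⟩

variable (ζ : ProbabilityMeasure C) {σ : Fin K → C → ℝ} (hσ : ∀ a, Measurable (σ a))
  {θ : C → Fin K → ℝ} (hθ : Measurable θ)

lemma coe_gaussianUnitLaw : (gaussianUnitLaw ζ hσ hθ : Measure (UnitData C K)) =
    ((ζ : Measure C).prod (gaussianNoise K)).map fun p => (p.1, locationScale σ θ p.1 p.2) := rfl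

lemma gaussianUnitLaw_fst : (gaussianUnitLaw ζ hσ hθ : Measure (UnitData C K)).fst = ζ := by
  rw [coe_gaussianUnitLaw, Measure.fst, Measure.map_map measurable_fst
    (measurable_fst.prodMk (measurable_locationScale hσ hθ))]
  exact Measure.fst_prod

/-- Conditional law of the outcomes as a kernel. -/
def gaussianKernel : Kernel C (Fin K → ℝ) :=
  (Kernel.id ×ₖ Kernel.const C (gaussianNoise K)).map fun p => locationScale σ θ p.1 p.2

lemma gaussianKernel_apply {σ : Fin K → C → ℝ} (hσ : ∀ a, Measurable (σ a))
    {θ : C → Fin K → ℝ} (hθ : Measurable θ) (x : C) :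
    gaussianKernel (σ := σ) (θ := θ) x = (gaussianNoise K).map (locationScale σ θ x) := by
  have hm := measurable_locationScale hσ hθ
  rw [gaussianKernel, Kernel.map_apply _ hm, Kernel.prod_apply, Kernel.id_apply,
    Kernel.const_apply, Measure.dirac_prod, Measure.map_map hm measurable_prodMk_left]
  rfl

/-- Uniqueness of disintegration: `gaussianKernel` composed with `ζ` gives back the joint law. Hence
the identification holds only almost everywhere. -/
lemma condLaw_gaussianUnitLaw : ∀ᵐ x ∂(ζ : Measure C),
    condLaw (gaussianUnitLaw ζ hσ hθ) x = (gaussianNoise K).map (locationScale σ θ x) := by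
  have hm := measurable_locationScale hσ hθ
  have : IsMarkovKernel (gaussianKernel (σ := σ) (θ := θ)) := by
    unfold gaussianKernel
    exact Kernel.IsMarkovKernel.map _ hm
  have h := eq_condKernel_of_measure_eq_compProd
    (ρ := (gaussianUnitLaw ζ hσ hθ : Measure (UnitData C K)))
    (gaussianKernel (σ := σ) (θ := θ)) (by
      rw [gaussianUnitLaw_fst]
      refine Measure.ext_of_lintegral _ fun f hf => ?_
      rw [Measure.lintegral_compProd hf, coe_gaussianUnitLaw,
        lintegral_map hf (measurable_fst.prodMk hm),
        lintegral_prod (fun p => f (p.1, locationScale σ θ p.1 p.2))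
          (hf.comp (measurable_fst.prodMk hm)).aemeasurable]
      refine lintegral_congr fun x => ?_
      rw [gaussianKernel_apply hσ hθ, lintegral_map (f := fun z => f (x, z)) (hf.comp measurable_prodMk_left)
        (measurable_locationScale_apply x)])
  rw [gaussianUnitLaw_fst] at h
  filter_upwards [h] with x hx
  rw [condLaw, ← hx, gaussianKernel_apply hσ hθ]

lemma condMean_gaussianUnitLaw : ∀ᵐ x ∂(ζ : Measure C), ∀ a,
    condMean (gaussianUnitLaw ζ hσ hθ) a x = θ x a := by
  filter_upwards [condLaw_gaussianUnitLaw ζ hσ hθ] with x hx a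
  have h := integral_map (μ := condLaw (gaussianUnitLaw ζ hσ hθ) x) (φ := fun y => y a)
    (measurable_pi_apply a).aemeasurable (f := id) (by fun_prop)
  rw [hx, map_eval_locationScale] at h
  rw [condMean, hx]
  exact h.symm.trans integral_id_gaussianReal

lemma hasSubgaussianMGF_of_map_eq_gaussianReal {α : Type*} [MeasurableSpace α] {μ : Measure α}
    {X : α → ℝ} (hX : Measurable X) {m : ℝ} {v : ℝ≥0} (h : μ.map X = gaussianReal m v) :
    HasSubgaussianMGF (fun y => X y - m) v μ := by
  have h0 : μ.map (fun y => X y - m) = gaussianReal 0 v := by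
    have : (fun y => X y - m) = (fun r => r - m) ∘ X := rfl
    rw [this, ← Measure.map_map (by fun_prop) hX, h, gaussianReal_map_sub_const, sub_self]
  refine ⟨fun t => ?_, fun t => ?_⟩
  · have := integrable_exp_mul_gaussianReal (μ := 0) (v := v) t
    rw [← h0, integrable_map_measure (by fun_prop) (by fun_prop)] at this
    exact this
  · rw [mgf_gaussianReal h0]
    simp

lemma integrable_outcome_gaussianUnitLaw (a : Fin K)
    (hθi : Integrable (fun x => θ x a) (ζ : Measure C)) (hσi : Integrable (σ a) (ζ : Measure C)) :
    Integrable (fun z : UnitData C K => z.2 a) (gaussianUnitLaw ζ hσ hθ) := by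
  rw [coe_gaussianUnitLaw, integrable_map_measure (by fun_prop)
    (measurable_fst.prodMk (measurable_locationScale hσ hθ)).aemeasurable]
  refine (hθi.comp_fst (gaussianNoise K)).add (hσi.mul_prod (g := fun z : Fin K → ℝ => z a) ?_)
  exact ((measurePreserving_eval (fun _ => gaussianReal 0 1) a).integrable_comp
    (g := id) (by fun_prop)).2 ((memLp_id_gaussianReal 1).integrable le_rfl)

lemma inModel_gaussianUnitLaw (hθi : ∀ a, Integrable (fun x => θ x a) (ζ : Measure C))
    (hσi : ∀ a, Integrable (σ a) (ζ : Measure C)) :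
    InModel ζ σ (gaussianUnitLaw ζ hσ hθ) where
  marginal := gaussianUnitLaw_fst ζ hσ hθ
  integrable a := integrable_outcome_gaussianUnitLaw ζ hσ hθ a (hθi a) (hσi a)
  condVariance a := by
    filter_upwards [condLaw_gaussianUnitLaw ζ hσ hθ] with x hx
    rw [hx]
    have := variance_map (μ := (gaussianNoise K).map (locationScale σ θ x)) (X := id)
      (Y := fun y : Fin K → ℝ => y a) (by fun_prop) (measurable_pi_apply a).aemeasurable
    rw [map_eval_locationScale, variance_id_gaussianReal] at this
    rw [← Function.id_comp (fun y : Fin K → ℝ => y a), ← this]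
    simp [sq_nonneg]
  subgaussian a := by
    filter_upwards [condLaw_gaussianUnitLaw ζ hσ hθ, condMean_gaussianUnitLaw ζ hσ hθ]
      with x hx hx'
    rw [hx, hx' a]
    exact ⟨_, hasSubgaussianMGF_of_map_eq_gaussianReal (measurable_pi_apply a)
      (map_eval_locationScale x a)⟩

/-- The law of an observation: only the noise of the assigned arm matters. -/
lemma lintegral_observe_gaussianUnitLaw {A : C → Fin K} (hA : Measurable A)
    {G : Obs C K → ℝ≥0∞} (hG : Measurable G) :
    ∫⁻ z, G (observe A z) ∂(gaussianUnitLaw ζ hσ hθ : Measure (UnitData C K)) =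
      ∫⁻ x, ∫⁻ y, G (x, A x, y)
        ∂(gaussianReal (θ x (A x)) (Real.toNNReal (σ (A x) x ^ 2))) ∂(ζ : Measure C) := by
  have hm := measurable_locationScale hσ hθ
  have hGo : Measurable fun z : UnitData C K => G (observe A z) := hG.comp (measurable_observe hA)
  rw [coe_gaussianUnitLaw, lintegral_map hGo (measurable_fst.prodMk hm),
    lintegral_prod (fun p => G (observe A (p.1, locationScale σ θ p.1 p.2)))
      (hGo.comp (measurable_fst.prodMk hm)).aemeasurable]
  refine lintegral_congr fun x => ?_
  have hGx : Measurable fun y : ℝ => G (x, A x, y) :=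
    hG.comp (measurable_const.prodMk (measurable_const.prodMk measurable_id))
  rw [← map_eval_locationScale x (A x), lintegral_map hGx (by fun_prop),
    lintegral_map (f := fun z : Fin K → ℝ => G (x, A x, z (A x)))
      (hGx.comp (measurable_pi_apply _)) (measurable_locationScale_apply x)]
  rfl

/-- Log-likelihood ratio of one observation when the mean of arm `a` in context `s` is moved from
`0` to `d`. -/
def logRatio [DecidableEq C] (σ : Fin K → C → ℝ) (s : C) (a : Fin K) (d : ℝ) (o : Obs C K) : ℝ :=
  if o.1 = s ∧ o.2.1 = a then (d * o.2.2 - d ^ 2 / 2) / σ a s ^ 2 else 0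

lemma measurableSet_context_arm [MeasurableSingletonClass C] (s : C) (a : Fin K) :
    MeasurableSet {o : Obs C K | o.1 = s ∧ o.2.1 = a} :=
  (measurable_fst (measurableSet_singleton s)).inter
    (measurable_snd.fst (measurableSet_singleton a))

lemma measurable_logRatio [DecidableEq C] [MeasurableSingletonClass C] (s : C) (a : Fin K)
    (d : ℝ) : Measurable (logRatio σ s a d) := by
  unfold logRatio
  exact Measurable.ite (measurableSet_context_arm s a) (by fun_prop) measurable_const

variable [DecidableEq C] [MeasurableSingletonClass C]

/-- Fibrewise over the context: where the shifted arm is assigned at `s`, the outcome law is tilted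
exponentially; elsewhere the two laws agree and `logRatio` is 0. The ratio is the same for every
rule `A`, as `Strategy.historyLaw_eq_withDensity` requires. -/
lemma lintegral_observe_shift (hσ0 : ∀ a x, 0 < σ a x) {θ' : C → Fin K → ℝ} (hθ' : Measurable θ')
    {s : C} {a : Fin K} {d : ℝ} (h0 : θ s a = 0) (hd : θ' s a = d)
    (hne : ∀ x b, ¬ (x = s ∧ b = a) → θ' x b = θ x b)
    {A : C → Fin K} (hA : Measurable A) {G : Obs C K → ℝ≥0∞} (hG : Measurable G) :
    ∫⁻ z, G (observe A z) ∂(gaussianUnitLaw ζ hσ hθ' : Measure (UnitData C K)) =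
      ∫⁻ z, ENNReal.ofReal (Real.exp (logRatio σ s a d (observe A z))) * G (observe A z)
        ∂(gaussianUnitLaw ζ hσ hθ : Measure (UnitData C K)) := by
  have hl : Measurable fun o : Obs C K => ENNReal.ofReal (Real.exp (logRatio σ s a d o)) :=
    (measurable_logRatio s a d).exp.ennreal_ofReal
  rw [lintegral_observe_gaussianUnitLaw ζ hσ hθ' hA hG,
    lintegral_observe_gaussianUnitLaw ζ hσ hθ hA (G := fun o =>
      ENNReal.ofReal (Real.exp (logRatio σ s a d o)) * G o) (hl.mul hG)]
  refine lintegral_congr fun x => ?_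
  simp only [logRatio]
  by_cases hx : x = s ∧ A x = a
  · obtain ⟨rfl, rfl⟩ := hx
    have hv : Real.toNNReal (σ (A x) x ^ 2) ≠ 0 := by
      have := hσ0 (A x) x
      simp only [ne_eq, Real.toNNReal_eq_zero, not_le]
      positivity
    have hGx : Measurable fun y : ℝ => G (x, A x, y) :=
      hG.comp (measurable_const.prodMk (measurable_const.prodMk measurable_id))
    rw [hd, h0, gaussianReal_eq_withDensity_zero d hv,
      lintegral_withDensity_eq_lintegral_mul _ (by fun_prop) hGx]
    simp [sq_nonneg]
  · simp [hx, hne _ _ hx]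

end Gaussian

/-! ## Testing a shift of one mean -/

section Testing

variable {Ω C : Type*} [MeasurableSpace Ω] [MeasurableSpace C] [DecidableEq C]
  [MeasurableSingletonClass C] {K : ℕ} {Pol : Set (C → Fin K → ℝ)}

/-- Expected number of rounds in which arm `a` is assigned in context `s`. -/
def Strategy.expectedCount (S : Strategy Ω C Pol) (ν : Measure Ω)
    (P : ProbabilityMeasure (UnitData C K)) (T : ℕ) (s : C) (a : Fin K) : ℝ :=
  ∫ p, ∑ i, (if (p.2 i).1 = s ∧ (p.2 i).2.1 = a then (1 : ℝ) else 0) ∂(S.historyLaw ν P T T)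

lemma measurable_count (T : ℕ) (s : C) (a : Fin K) :
    Measurable fun p : Ω × (Fin T → Obs C K) =>
      ∑ i, (if (p.2 i).1 = s ∧ (p.2 i).2.1 = a then (1 : ℝ) else 0) := by
  have : Measurable fun o : Obs C K => if o.1 = s ∧ o.2.1 = a then (1 : ℝ) else 0 :=
    Measurable.ite (measurableSet_context_arm s a) measurable_const measurable_const
  exact Finset.measurable_fun_sum _ fun i _ => this.comp measurable_snd.eval

lemma Strategy.integrable_count (S : Strategy Ω C Pol) (ν : Measure Ω) [IsProbabilityMeasure ν]
    (P : ProbabilityMeasure (UnitData C K)) (T : ℕ) (s : C) (a : Fin K) :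
    Integrable (fun p => ∑ i, (if (p.2 i).1 = s ∧ (p.2 i).2.1 = a then (1 : ℝ) else 0))
      (S.historyLaw ν P T T) := by
  refine Integrable.of_mem_Icc 0 T (measurable_count T s a).aemeasurable (ae_of_all _ fun p => ?_)
  refine ⟨Finset.sum_nonneg fun i _ => by split_ifs <;> simp, ?_⟩
  calc _ ≤ ∑ _i : Fin T, (1 : ℝ) := Finset.sum_le_sum fun i _ => by split_ifs <;> simp
    _ = T := by simp

/-- Each round assigns exactly one arm, so the counts at `s` add up to the number of visits to `s`,
which no strategy can influence. This is the budget constraint behind the lower bound. -/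
lemma Strategy.sum_expectedCount (S : Strategy Ω C Pol) (ν : Measure Ω) [IsProbabilityMeasure ν]
    (P : ProbabilityMeasure (UnitData C K)) {ζ : ProbabilityMeasure C}
    (hP : (P : Measure (UnitData C K)).fst = ζ) (T : ℕ) (s : C) :
    ∑ a, S.expectedCount ν P T s a = T * (ζ : Measure C).real {s} := by
  unfold Strategy.expectedCount
  rw [← integral_finsetSum _ fun a _ => S.integrable_count ν P T s a]
  have hs : MeasurableSet {z : UnitData C K | z.1 = s} :=
    measurable_fst (measurableSet_singleton s)
  have hφ : Measurable fun o : Obs C K => if o.1 = s then (1 : ℝ) else 0 :=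
    Measurable.ite (measurable_fst (measurableSet_singleton s)) measurable_const measurable_const
  have hφz : Measurable fun z : UnitData C K => if z.1 = s then (1 : ℝ) else 0 :=
    Measurable.ite hs measurable_const measurable_const
  have h := (S.integral_sum_historyLaw ν P hφ (c := (ζ : Measure C).real {s})
    (fun b => Integrable.of_mem_Icc 0 1 hφz.aemeasurable (ae_of_all _ fun z => by
      dsimp only
      split_ifs <;> simp)) (fun A _ => by
        have : (fun z : UnitData C K => if (observe A z).1 = s then (1 : ℝ) else 0) =
          {z : UnitData C K | z.1 = s}.indicator 1 := by
          ext z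
          by_cases hz : z.1 = s <;> simp [observe, hz]
        rw [this, integral_indicator_one hs, ← hP, measureReal_def, measureReal_def,
          Measure.fst_apply (measurableSet_singleton s)]
        rfl) T T).2
  rw [← h]
  refine integral_congr_ae (ae_of_all _ fun p => ?_)
  dsimp only
  rw [Finset.sum_comm]
  refine Finset.sum_congr rfl fun i _ => ?_
  by_cases hi : (p.2 i).1 = s <;> simp [hi]

variable (ζ : ProbabilityMeasure C) {σ : Fin K → C → ℝ} (hσ : ∀ a, Measurable (σ a))
  {θ : C → Fin K → ℝ} (hθ : Measurable θ)

/-- Outcomes of an arm with mean zero average out, whatever the assignment rule. -/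
lemma integral_observe_eq_zero (hθi : ∀ a, Integrable (fun x => θ x a) (ζ : Measure C))
    (hσi : ∀ a, Integrable (σ a) (ζ : Measure C)) {s : C} {a : Fin K} (h0 : θ s a = 0)
    (A : C → Fin K) :
    ∫ z, (if (observe A z).1 = s ∧ (observe A z).2.1 = a then (observe A z).2.2 else 0)
      ∂(gaussianUnitLaw ζ hσ hθ : Measure (UnitData C K)) = 0 := by
  have hs : MeasurableSet {z : UnitData C K | z.1 = s} :=
    measurable_fst (measurableSet_singleton s)
  by_cases hA : A s = a
  · have hrw : (fun z : UnitData C K =>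
        if (observe A z).1 = s ∧ (observe A z).2.1 = a then (observe A z).2.2 else 0) =
        {z : UnitData C K | z.1 = s}.indicator fun z => z.2 a := by
      ext ⟨x, y⟩
      by_cases hx : x = s
      · subst hx
        simp [observe, hA]
      · simp [observe, hx]
    have hi := (integrable_outcome_gaussianUnitLaw ζ hσ hθ a (hθi a) (hσi a)).indicator hs
    have hm := measurable_fst.prodMk (measurable_locationScale hσ hθ)
    rw [hrw]
    rw [coe_gaussianUnitLaw] at hi ⊢
    rw [integral_map hm.aemeasurable hi.aestronglyMeasurable, integral_prod
      (fun p => {z : UnitData C K | z.1 = s}.indicator (fun z => z.2 a)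
        (p.1, locationScale σ θ p.1 p.2)) ((integrable_map_measure hi.aestronglyMeasurable hm.aemeasurable).1 hi)]
    refine integral_eq_zero_of_ae (ae_of_all _ fun x => ?_)
    by_cases hx : x = s
    · subst hx
      have hz : ∫ z : Fin K → ℝ, z a ∂(gaussianNoise K) = 0 := by
        have h2 := integral_map (μ := gaussianNoise K) (φ := Function.eval a)
          (measurable_pi_apply a).aemeasurable (f := id) (by fun_prop)
        rw [(measurePreserving_eval (fun _ => gaussianReal 0 1) a).map_eq] at h2
        exact h2.symm.trans integral_id_gaussianReal
      simp [locationScale, h0, integral_const_mul, hz]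
    · simp [hx]
  · refine integral_eq_zero_of_ae (ae_of_all _ fun z => ?_)
    have : ¬ ((observe A z).1 = s ∧ (observe A z).2.1 = a) := by
      rintro ⟨h1, h2⟩
      simp only [observe] at h1 h2
      exact hA (h1 ▸ h2)
    simp [this]

/-- Moving the mean of one arm in one context from `0` to `d` changes expectations of statistics
with values in `[0, 1]` by at most the relative entropy plus `1 / 8`. -/
lemma Strategy.integral_sub_integral_shift_le (S : Strategy Ω C Pol) (ν : Measure Ω)
    [IsProbabilityMeasure ν] (hσ0 : ∀ a x, 0 < σ a x)
    (hθi : ∀ a, Integrable (fun x => θ x a) (ζ : Measure C))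
    (hσi : ∀ a, Integrable (σ a) (ζ : Measure C))
    {θ' : C → Fin K → ℝ} (hθ' : Measurable θ')
    {s : C} {a : Fin K} {d : ℝ} (h0 : θ s a = 0) (hd : θ' s a = d)
    (hne : ∀ x b, ¬ (x = s ∧ b = a) → θ' x b = θ x b) (T : ℕ)
    {f : Ω × (Fin T → Obs C K) → ℝ} (hf : Measurable f) (hf1 : ∀ p, f p ∈ Set.Icc (0 : ℝ) 1) :
    (∫ p, f p ∂(S.historyLaw ν (gaussianUnitLaw ζ hσ hθ) T T)) -
        ∫ p, f p ∂(S.historyLaw ν (gaussianUnitLaw ζ hσ hθ') T T) ≤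
      d ^ 2 / (2 * σ a s ^ 2) * S.expectedCount ν (gaussianUnitLaw ζ hσ hθ) T s a + 1 / 8 := by
  set P := gaussianUnitLaw ζ hσ hθ with hP
  set L : Ω × (Fin T → Obs C K) → ℝ := fun p => ∑ i, logRatio σ s a d (p.2 i) with hL
  have hLm : Measurable L :=
    Finset.measurable_fun_sum _ fun i _ => (measurable_logRatio s a d).comp measurable_snd.eval
  have hdens := S.historyLaw_eq_withDensity ν P (gaussianUnitLaw ζ hσ hθ')
    (l := fun o => ENNReal.ofReal (Real.exp (logRatio σ s a d o)))
    (measurable_logRatio s a d).exp.ennreal_ofReal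
    (fun A hA G hG => lintegral_observe_shift ζ hσ hθ hσ0 hθ' h0 hd hne hA hG) T T
  simp_rw [← ENNReal.ofReal_prod_of_nonneg fun i _ => (Real.exp_pos _).le, ← Real.exp_sum]
    at hdens
  set φ : Obs C K → ℝ := fun o => if o.1 = s ∧ o.2.1 = a then o.2.2 else 0 with hφ
  have hφm : Measurable φ :=
    Measurable.ite (measurableSet_context_arm s a) (by fun_prop) measurable_const
  obtain ⟨hφi, hφ0⟩ := S.integral_sum_historyLaw ν P hφm (c := 0) (fun b => by
    refine (integrable_outcome_gaussianUnitLaw ζ hσ hθ b (hθi b) (hσi b)).mono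
      (hφm.comp (g := φ) (f := fun z : UnitData C K => (z.1, b, z.2 b))
        (by fun_prop)).aestronglyMeasurable (ae_of_all _ fun z => ?_)
    simp only [hφ]
    split_ifs <;> simp) (fun A _ => integral_observe_eq_zero ζ hσ hθ hθi hσi h0 A) T T
  -- The part linear in the outcomes has expectation 0 under `P`; the count is what remains of the
  -- relative entropy.
  have hLeq : ∀ p, L p = d / σ a s ^ 2 * ∑ i, φ (p.2 i) - d ^ 2 / (2 * σ a s ^ 2) *
      ∑ i, (if (p.2 i).1 = s ∧ (p.2 i).2.1 = a then (1 : ℝ) else 0) := by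
    intro p
    rw [Finset.mul_sum, Finset.mul_sum, ← Finset.sum_sub_distrib]
    refine Finset.sum_congr rfl fun i _ => ?_
    have := (hσ0 a s).ne'
    simp only [hφ, logRatio]
    split_ifs
    · field_simp
    · simp
  have hc := S.integrable_count ν P T s a
  have hLi : Integrable L (S.historyLaw ν P T T) :=
    ((hφi.const_mul _).sub (hc.const_mul _)).congr (ae_of_all _ fun p => (hLeq p).symm)
  have hLint : ∫ p, L p ∂(S.historyLaw ν P T T) =
      -(d ^ 2 / (2 * σ a s ^ 2) * S.expectedCount ν P T s a) := by
    simp_rw [hLeq]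
    rw [integral_sub (hφi.const_mul _) (hc.const_mul _), integral_const_mul, integral_const_mul,
      hφ0]
    simp [Strategy.expectedCount]
  have := integral_sub_integral_le_neg_integral_log_density hLm hdens hLi hf hf1
  rwa [hLint, neg_neg] at this

end Testing

/-! ## Uniform context distributions -/

section Uniform

variable {C : Type*} [MeasurableSpace C]

/-- The uniform distribution on a non-empty finite set. -/
def uniformLaw (F : Finset C) (hF : F.Nonempty) : ProbabilityMeasure C :=
  ⟨(F.card : ℝ≥0∞)⁻¹ • ∑ s ∈ F, Measure.dirac s, ⟨by
    have : (F.card : ℝ≥0∞) ≠ 0 := by simpa using hF.ne_empty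
    simp [ENNReal.inv_mul_cancel this]⟩⟩

variable {F : Finset C} (hF : F.Nonempty)

lemma coe_uniformLaw : (uniformLaw F hF : Measure C) =
    (F.card : ℝ≥0∞)⁻¹ • ∑ s ∈ F, Measure.dirac s := rfl

variable [MeasurableSingletonClass C]

/-- Each point of `F` has positive mass. Almost sure statements, null consistency among them, can
thus be used at a single context. -/
lemma ae_uniformLaw_iff {p : C → Prop} :
    (∀ᵐ x ∂(uniformLaw F hF : Measure C), p x) ↔ ∀ s ∈ F, p s := by
  rw [coe_uniformLaw, Measure.ae_ennreal_smul_measure_iff (by simp), ae_iff]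
  simp [Measure.finsetSum_apply, Finset.sum_eq_zero_iff, Measure.dirac_apply]

lemma integrable_uniformLaw (f : C → ℝ) : Integrable f (uniformLaw F hF : Measure C) := by
  rw [coe_uniformLaw]
  refine Integrable.smul_measure (integrable_finsetSum_measure.2 fun s _ =>
    integrable_dirac (by simp)) (by simpa using hF.ne_empty)

lemma integral_uniformLaw (f : C → ℝ) :
    ∫ x, f x ∂(uniformLaw F hF : Measure C) = (F.card : ℝ)⁻¹ * ∑ s : F, f s := by
  rw [coe_uniformLaw, integral_smul_measure, integral_finsetSum_measure fun s _ =>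
    integrable_dirac (by simp)]
  simp [Finset.sum_attach F f]

lemma uniformLaw_real_singleton {s : C} (hs : s ∈ F) :
    (uniformLaw F hF : Measure C).real {s} = (F.card : ℝ)⁻¹ := by
  classical
  rw [← integral_indicator_one (measurableSet_singleton s), integral_uniformLaw,
    Finset.sum_eq_single ⟨s, hs⟩]
  · simp
  · rintro ⟨t, ht⟩ _ hne
    have : t ≠ s := by simpa using hne
    simp [this]
  · simp

lemma measurable_of_finite_support {K : ℕ} {θ : C → Fin K → ℝ} (h : ∀ x ∉ F, θ x = 0) :
    Measurable θ := by
  classical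
  have : θ = fun x => ∑ s ∈ F, if x = s then θ s else 0 := by
    ext1 x
    by_cases hx : x ∈ F
    · simp [hx]
    · simp [hx, h x hx]
  rw [this]
  exact Finset.measurable_fun_sum _ fun s _ =>
    Measurable.ite (measurableSet_singleton s) measurable_const measurable_const

end Uniform

/-! ## Regret lower bounds -/

section Regret

variable {Ω C : Type*} [MeasurableSpace Ω] [MeasurableSpace C]
  {K : ℕ} {Pol : Set (C → Fin K → ℝ)}

lemma IsPolicy.mem_Icc {π : C → Fin K → ℝ} (hπ : IsPolicy π) (x : C) (a : Fin K) :
    π x a ∈ Set.Icc (0 : ℝ) 1 :=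
  ⟨hπ.nonneg x a, (Finset.single_le_sum (fun b _ => hπ.nonneg x b) (Finset.mem_univ a)).trans
    (hπ.sum_eq_one x).le⟩

lemma Strategy.integrable_policy (hPol : ∀ π ∈ Pol, IsPolicy π) (S : Strategy Ω C Pol)
    (ν : Measure Ω) [IsProbabilityMeasure ν] (P : ProbabilityMeasure (UnitData C K)) (T : ℕ)
    (x : C) (a : Fin K) :
    Integrable (fun p => S.policy T p.1 p.2 x a) (S.historyLaw ν P T T) :=
  Integrable.of_mem_Icc 0 1 (S.measurable_policy T x a).aemeasurable
    (ae_of_all _ fun p => (hPol _ (S.policy_mem T p.1 p.2)).mem_Icc x a)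

lemma Strategy.sum_recommendProb (hPol : ∀ π ∈ Pol, IsPolicy π) (S : Strategy Ω C Pol)
    (ν : Measure Ω) [IsProbabilityMeasure ν] (P : ProbabilityMeasure (UnitData C K)) (T : ℕ)
    (x : C) : ∑ a, S.recommendProb ν P T x a = 1 := by
  unfold Strategy.recommendProb
  rw [← integral_finsetSum _ fun a _ => S.integrable_policy hPol ν P T x a]
  simp_rw [fun p : Ω × (Fin T → Obs C K) => (hPol _ (S.policy_mem T p.1 p.2)).sum_eq_one x]
  simp

variable [MeasurableSingletonClass C] {F : Finset C} (hF : F.Nonempty)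
  {σ : Fin K → C → ℝ} (hσ : ∀ a, Measurable (σ a)) {θ : C → Fin K → ℝ} (hθ : Measurable θ)

lemma inModel_uniformLaw :
    InModel (uniformLaw F hF) σ (gaussianUnitLaw (uniformLaw F hF) hσ hθ) :=
  inModel_gaussianUnitLaw _ hσ hθ (fun _ => integrable_uniformLaw hF _)
    fun _ => integrable_uniformLaw hF _

lemma condMean_uniformLaw {s : C} (hs : s ∈ F) (a : Fin K) :
    condMean (gaussianUnitLaw (uniformLaw F hF) hσ hθ) a s = θ s a :=
  (ae_uniformLaw_iff hF).1 (condMean_gaussianUnitLaw (uniformLaw F hF) hσ hθ) s hs a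

lemma policyValue_uniformLaw (π : C → Fin K → ℝ) :
    policyValue (gaussianUnitLaw (uniformLaw F hF) hσ hθ) π =
      (F.card : ℝ)⁻¹ * ∑ s : F, ∑ a, π s a * θ s a := by
  rw [policyValue, gaussianUnitLaw_fst, integral_uniformLaw]
  simp_rw [fun s : F => fun a => condMean_uniformLaw hF hσ hθ s.2 a]

/-- Any policy of the class may serve as comparator in place of the supremum; since the value is
linear in the policy, only recommendation probabilities remain after averaging. -/
lemma Strategy.le_expectedRegret (hPol : ∀ π ∈ Pol, IsPolicy π) (S : Strategy Ω C Pol)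
    (ν : Measure Ω) [IsProbabilityMeasure ν] (T : ℕ) {π : C → Fin K → ℝ} (hπ : π ∈ Pol) :
    (F.card : ℝ)⁻¹ * ∑ s : F, ∑ a, (π s a -
        S.recommendProb ν (gaussianUnitLaw (uniformLaw F hF) hσ hθ) T s a) * θ s a ≤
      S.expectedRegret ν (gaussianUnitLaw (uniformLaw F hF) hσ hθ) T := by
  set P := gaussianUnitLaw (uniformLaw F hF) hσ hθ with hP
  -- A real `sSup` dominates the elements of the set only if the set is bounded above.
  have hbdd : BddAbove (policyValue P '' Pol) := by
    refine ⟨(F.card : ℝ)⁻¹ * ∑ s : F, ∑ a, |θ s a|, ?_⟩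
    rintro _ ⟨ρ, hρ, rfl⟩
    rw [hP, policyValue_uniformLaw]
    gcongr with s _ a _
    have := (hPol ρ hρ).mem_Icc s a
    calc ρ s a * θ s a ≤ ρ s a * |θ s a| := by gcongr; exacts [this.1, le_abs_self _]
      _ ≤ 1 * |θ s a| := by gcongr; exact this.2
      _ = _ := one_mul _
  have hi : ∀ (s : F) (a : Fin K), Integrable
      (fun p => S.policy T p.1 p.2 s a * θ s a) (S.historyLaw ν P T T) := fun s a =>
    (S.integrable_policy hPol ν P T s a).mul_const _
  have hval : ∫ p, policyValue P (S.policy T p.1 p.2) ∂(S.historyLaw ν P T T) =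
      (F.card : ℝ)⁻¹ * ∑ s : F, ∑ a, S.recommendProb ν P T s a * θ s a := by
    simp_rw [hP, policyValue_uniformLaw]
    rw [← hP, integral_const_mul, integral_finsetSum _ fun s _ => integrable_finsetSum _ fun a _ =>
      hi s a]
    simp_rw [integral_finsetSum _ fun a _ => hi _ a, integral_mul_const]
    rfl
  have hvali : Integrable (fun p => policyValue P (S.policy T p.1 p.2))
      (S.historyLaw ν P T T) := by
    simp_rw [hP, policyValue_uniformLaw]
    exact (integrable_finsetSum _ fun s _ => integrable_finsetSum _ fun a _ => hi s a).const_mul _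
  have hle := le_csSup hbdd ⟨π, hπ, rfl⟩
  simp_rw [Strategy.expectedRegret, simpleRegret]
  rw [integral_sub (integrable_const _) hvali, hval]
  simp only [integral_const, probReal_univ, smul_eq_mul, one_mul, sub_mul,
    Finset.sum_sub_distrib, mul_sub]
  have := policyValue_uniformLaw hF hσ hθ π
  rw [← hP] at this
  linarith

end Regret

/-! ## Labellings of a shattered set -/

section Labelling

variable {C : Type*} {K : ℕ}

/-- Some policy of the class deterministically recommends `g` on `F`. -/
def Realizes (Pol : Set (C → Fin K → ℝ)) (F : Finset C) (g : C → Fin K) : Prop :=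
  ∃ π ∈ Pol, ∀ s ∈ F, Recommends π s (g s)

variable {Pol : Set (C → Fin K → ℝ)} {F : Finset C} [DecidableEq C]

/-- The labels of `g₀` are replaced by those of `g` one point of `F` at a time. -/
lemma realizes_of_update_closed (h : ∀ g, Realizes Pol F g → ∀ s ∈ F, ∀ a,
    Realizes Pol F (Function.update g s a)) {g₀ : C → Fin K} (h₀ : Realizes Pol F g₀)
    (g : C → Fin K) : Realizes Pol F g := by
  have key : ∀ G : Finset C, G ⊆ F → Realizes Pol F fun x => if x ∈ G then g x else g₀ x := by
    intro G
    induction G using Finset.induction_on with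
    | empty => simpa using h₀
    | insert s G hs ih =>
      intro hG
      convert h _ (ih ((Finset.subset_insert _ _).trans hG)) s (hG (Finset.mem_insert_self _ _))
        (g s) using 1
      ext1 x
      by_cases hx : x = s
      · subst hx
        simp
      · simp [hx]
  obtain ⟨π, hπ, hr⟩ := key F subset_rfl
  exact ⟨π, hπ, fun s hs => by simpa [hs] using hr s hs⟩

/-- If moving `g` to `a` at `s` leaves the class, recommending `a` at `s` costs deviations
from `g` elsewhere. -/
lemma apply_le_sum_deviation (hdet : DeterministicallyGenerated Pol F) {g : C → Fin K} {s : C}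
    (hs : s ∈ F) {a : Fin K} (hg : ¬ Realizes Pol F (Function.update g s a))
    {π : C → Fin K → ℝ} (hπ : π ∈ Pol) :
    π s a ≤ ∑ t : F, if (t : C) = s then 0 else 1 - π t (g t) := by
  -- The claim is an affine inequality in the policy, so it cuts out a convex set and needs checking
  -- only for policies deterministic on `F`.
  let Q : Set (F → Fin K → ℝ) :=
    {q | q ⟨s, hs⟩ a ≤ ∑ t : F, if (t : C) = s then 0 else 1 - q t (g t)}
  have hQ : Convex ℝ Q := by
    intro q hq q' hq' α β hα hβ hαβ
    have h1 := mul_le_mul_of_nonneg_left (show q ⟨s, hs⟩ a ≤ _ from hq) hα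
    have h2 := mul_le_mul_of_nonneg_left (show q' ⟨s, hs⟩ a ≤ _ from hq') hβ
    change α * q ⟨s, hs⟩ a + β * q' ⟨s, hs⟩ a ≤ ∑ t : F,
      if (t : C) = s then 0 else 1 - (α * q t (g t) + β * q' t (g t))
    refine (add_le_add h1 h2).trans (le_of_eq ?_)
    rw [Finset.mul_sum, Finset.mul_sum, ← Finset.sum_add_distrib]
    refine Finset.sum_congr rfl fun t _ => ?_
    split_ifs
    · simp
    · linear_combination hαβ
  have hsub : (fun (π' : C → Fin K → ℝ) (s : F) => π' s) ''
      {π' | π' ∈ Pol ∧ ∀ s ∈ F, ∃ a, Recommends π' s a} ⊆ Q := by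
    rintro _ ⟨ρ, ⟨hρ, hr⟩, rfl⟩
    have : Nonempty (Fin K) := ⟨a⟩
    choose! b hb using hr
    have hρb : ∀ t ∈ F, ρ t = Pi.single (b t) 1 := hb
    change ρ s a ≤ ∑ t : F, if (t : C) = s then 0 else 1 - ρ t (g t)
    have hnn : ∀ t : F, 0 ≤ if (t : C) = s then 0 else 1 - ρ t (g t) := by
      intro t
      split_ifs
      · exact le_rfl
      · rw [hb t t.2, Pi.single_apply]
        split_ifs <;> simp
    by_cases hba : b s = a
    -- Without such a `t`, `ρ` would realize the changed labelling. The deviation at `t` contributes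
    -- 1 to the right-hand side.
    · obtain ⟨t, ht, hts, htg⟩ : ∃ t ∈ F, t ≠ s ∧ b t ≠ g t := by
        by_contra! hcon
        refine hg ⟨ρ, hρ, fun t ht => ?_⟩
        by_cases hts : t = s
        · subst hts
          simpa [hba] using hb t ht
        · simpa [hts, hcon t ht hts] using hb t ht
      refine le_trans ?_ (Finset.single_le_sum (fun t _ => hnn t) (Finset.mem_univ ⟨t, ht⟩))
      simp [hts, hρb t ht, hρb s hs, htg.symm, hba]
    · rw [hb s hs, Pi.single_apply, if_neg (fun h => hba h.symm)]
      exact Finset.sum_nonneg fun t _ => hnn t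
  exact convexHull_min hsub hQ (hdet π hπ)

end Labelling

/-! ## Product priors -/

section Prior

variable {ι U : Type*} [Fintype ι] [DecidableEq ι] [Fintype U] {W : ι → U → ℝ}

/-- Resampling one coordinate does not change an average over a product prior. -/
lemma sum_prior_eq_sum_resample {s : ι} (hW : ∑ u, W s u = 1) (f : (ι → U) → ℝ) :
    ∑ v, (∏ i, W i (v i)) * f v =
      ∑ v, (∏ i, W i (v i)) * ∑ u, W s u * f (Function.update v s u) := by
  have key : ∀ (v : ι → U) (u : U),
      (∏ i, W i (Function.update v s u i)) * W s (v s) = (∏ i, W i (v i)) * W s u := by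
    intro v u
    rw [← Finset.mul_prod_erase _ (fun i => W i (Function.update v s u i)) (Finset.mem_univ s),
      ← Finset.mul_prod_erase _ (fun i => W i (v i)) (Finset.mem_univ s)]
    rw [Finset.prod_congr rfl (fun i hi => by
      rw [Function.update_of_ne (Finset.ne_of_mem_erase hi)] :
      ∀ i ∈ Finset.univ.erase s, W i (Function.update v s u i) = W i (v i))]
    simp
    ring
  calc ∑ v, (∏ i, W i (v i)) * f v
      = ∑ x : (ι → U) × U, (∏ i, W i (x.1 i)) * W s x.2 * f x.1 := by
        rw [Fintype.sum_prod_type]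
        refine Finset.sum_congr rfl fun v _ => ?_
        simp_rw [mul_right_comm _ _ (f v)]
        rw [← Finset.mul_sum, hW, mul_one]
    _ = ∑ x : (ι → U) × U,
          (∏ i, W i (x.1 i)) * W s x.2 * f (Function.update x.1 s x.2) := by
        -- Swapping coordinate `s` of `v` with the fresh draw is an involution that preserves the
        -- product weight.
        have hinv : Function.Involutive
            fun x : (ι → U) × U => (Function.update x.1 s x.2, x.1 s) := fun x => by simp
        refine Fintype.sum_equiv hinv.toPerm _ _ fun x => ?_
        change _ = (∏ i, W i (Function.update x.1 s x.2 i)) * W s (x.1 s) *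
          f (Function.update (Function.update x.1 s x.2) s (x.1 s))
        rw [key]
        simp
    _ = _ := by
        rw [Fintype.sum_prod_type]
        refine Finset.sum_congr rfl fun v _ => ?_
        rw [Finset.mul_sum]
        exact Finset.sum_congr rfl fun u _ => mul_assoc _ _ _

/-- If, on average over each single coordinate, `r s` is at least `B s`, then some point has
`∑ s, r s` at least `∑ s, B s`. -/
lemma exists_sum_le_of_resample [Nonempty U] (hW0 : ∀ s u, 0 < W s u) (hW : ∀ s, ∑ u, W s u = 1)
    {r : ι → (ι → U) → ℝ} {B : ι → ℝ}
    (hr : ∀ s v, B s ≤ ∑ u, W s u * r s (Function.update v s u)) :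
    ∃ v, ∑ s, B s ≤ ∑ s, r s v := by
  by_contra! hcon
  have htot : ∑ v : ι → U, ∏ i, W i (v i) = 1 := by
    rw [← Fintype.prod_sum]
    simp [hW]
  have h1 : ∑ v : ι → U, (∏ i, W i (v i)) * ∑ s, r s v < ∑ s, B s := by
    calc _ < ∑ v : ι → U, (∏ i, W i (v i)) * ∑ s, B s :=
          Finset.sum_lt_sum_of_nonempty Finset.univ_nonempty fun v _ =>
            mul_lt_mul_of_pos_left (hcon v) (Finset.prod_pos fun i _ => hW0 i _)
      _ = _ := by rw [← Finset.sum_mul, htot, one_mul]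
  have h2 : ∑ s, B s ≤ ∑ v : ι → U, (∏ i, W i (v i)) * ∑ s, r s v := by
    simp_rw [Finset.mul_sum]
    rw [Finset.sum_comm]
    refine Finset.sum_le_sum fun s _ => ?_
    rw [sum_prior_eq_sum_resample (hW s)]
    calc B s = ∑ v : ι → U, (∏ i, W i (v i)) * B s := by rw [← Finset.sum_mul, htot, one_mul]
      _ ≤ _ := Finset.sum_le_sum fun v _ =>
        mul_le_mul_of_nonneg_left (hr s v) (Finset.prod_pos fun i _ => hW0 i _).le
  exact absurd h1 h2.not_gt

end Prior

/-! ## The lower bound for classes realizing all labellings -/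

section LowerBound

variable {Ω C : Type*} [MeasurableSpace Ω] [MeasurableSpace C] [DecidableEq C]
  [MeasurableSingletonClass C] {K : ℕ} {Pol : Set (C → Fin K → ℝ)}

/-- `true` for a good arm, `false` for a bad arm. -/
def signedShift (d : ℝ) (b : Bool) : ℝ := if b then d else -d

/-- Probability of not recommending the good arm, or of recommending the bad one. -/
def errorProb (p : Fin K → ℝ) (u : Fin K × Bool) : ℝ := if u.2 then 1 - p u.1 else p u.1

/-- Average over a random good or bad arm at a single context of the error probability. -/
lemma Strategy.quarter_le_sum_errorProb (hPol : ∀ π ∈ Pol, IsPolicy π) (S : Strategy Ω C Pol)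
    (ν : Measure Ω) [IsProbabilityMeasure ν] {F : Finset C} (hF : F.Nonempty)
    {σ : Fin K → C → ℝ} (hσ : ∀ a, Measurable (σ a)) (hσ0 : ∀ a x, 0 < σ a x)
    {θ : C → Fin K → ℝ} (hθ : Measurable θ) {s : C} (hs : s ∈ F) (h0 : θ s = 0)
    {θ' : Fin K × Bool → C → Fin K → ℝ} (hθ' : ∀ u, Measurable (θ' u)) {T : ℕ} (hT : 0 < T)
    {V d : ℝ} (hV : V = ∑ a, σ a s ^ 2) (hV0 : 0 < V) (hd : d = 1 / 2 * √(F.card * V / T))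
    (hs' : ∀ u, θ' u s = Pi.single u.1 (signedShift d u.2))
    (hne : ∀ u, ∀ x ≠ s, θ' u x = θ x) :
    1 / 4 ≤ ∑ u : Fin K × Bool, σ u.1 s ^ 2 / (2 * V) * errorProb
      (S.recommendProb ν (gaussianUnitLaw (uniformLaw F hF) hσ (hθ' u)) T s) u := by
  set P₀ := gaussianUnitLaw (uniformLaw F hF) hσ hθ with hP₀
  have hds : ∀ b, signedShift d b ^ 2 = d ^ 2 := by
    intro b
    cases b <;> simp [signedShift]
  have hT0 : (0 : ℝ) < T := by exact_mod_cast hT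
  have hM0 : (0 : ℝ) < F.card := by exact_mod_cast hF.card_pos
  have hdsq : d ^ 2 = F.card * V / (4 * T) := by
    rw [hd, mul_pow, Real.sq_sqrt (by positivity)]
    field_simp
    norm_num
  have hshift : ∀ (u : Fin K × Bool) (f : Ω × (Fin T → Obs C K) → ℝ), Measurable f →
      (∀ p, f p ∈ Set.Icc (0 : ℝ) 1) →
      (∫ p, f p ∂(S.historyLaw ν P₀ T T)) -
        ∫ p, f p ∂(S.historyLaw ν (gaussianUnitLaw (uniformLaw F hF) hσ (hθ' u)) T T) ≤
      d ^ 2 / (2 * σ u.1 s ^ 2) * S.expectedCount ν P₀ T s u.1 + 1 / 8 := by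
    intro u f hf hf1
    have := S.integral_sub_integral_shift_le (uniformLaw F hF) hσ hθ ν hσ0
      (fun _ => integrable_uniformLaw hF _) (fun _ => integrable_uniformLaw hF _) (hθ' u)
      (s := s) (a := u.1) (d := signedShift d u.2) (by simp [h0]) (by simp [hs'])
      (fun x b hxb => by
        by_cases hx : x = s
        · subst hx
          have hb : b ≠ u.1 := fun h => hxb ⟨rfl, h⟩
          simp [hs', h0, hb]
        · rw [hne u x hx]) T hf hf1
    rwa [hds] at this
  have hpol : ∀ (a : Fin K) (p : Ω × (Fin T → Obs C K)),
      S.policy T p.1 p.2 s a ∈ Set.Icc (0 : ℝ) 1 := fun a p =>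
    (hPol _ (S.policy_mem T p.1 p.2)).mem_Icc s a
  -- Under `P₀` the errors for a good and a bad arm `a` sum to 1; the two changes of measure take
  -- away 2 · 1/8 and twice the relative entropy, whose factor 1/σ² the weight cancels.
  have hpair : ∀ a, σ a s ^ 2 / (2 * V) * (3 / 4) -
      d ^ 2 / (2 * V) * S.expectedCount ν P₀ T s a ≤
      ∑ b : Bool, σ a s ^ 2 / (2 * V) * errorProb
        (S.recommendProb ν (gaussianUnitLaw (uniformLaw F hF) hσ (hθ' (a, b))) T s) (a, b) := by
    intro a
    have h1 := hshift (a, true) (fun p => 1 - S.policy T p.1 p.2 s a)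
      (measurable_const.sub (S.measurable_policy T s a))
      (fun p => ⟨by linarith [(hpol a p).2], by linarith [(hpol a p).1]⟩)
    have h2 := hshift (a, false) (fun p => S.policy T p.1 p.2 s a)
      (S.measurable_policy T s a) (hpol a)
    rw [integral_sub (integrable_const _) (S.integrable_policy hPol ν _ T s a),
      integral_sub (integrable_const _) (S.integrable_policy hPol ν _ T s a)] at h1
    simp only [integral_const, probReal_univ, smul_eq_mul, mul_one] at h1
    simp only [Fintype.sum_bool, errorProb, if_true, Bool.false_eq_true, if_false,
      Strategy.recommendProb]
    have hpos := hσ0 a s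
    have hw : 0 ≤ σ a s ^ 2 / (2 * V) := by positivity
    have hkl : σ a s ^ 2 / (2 * V) * (2 * (d ^ 2 / (2 * σ a s ^ 2) *
        S.expectedCount ν P₀ T s a)) = d ^ 2 / (2 * V) * S.expectedCount ν P₀ T s a := by
      field_simp
    rw [← hkl, ← mul_sub, ← mul_add]
    refine mul_le_mul_of_nonneg_left ?_ hw
    linarith
  rw [Fintype.sum_prod_type]
  refine le_trans ?_ (Finset.sum_le_sum fun a _ => hpair a)
  -- The counts sum to T/M, so the total is 3/8 − d²T/(2MV) = 3/8 − 1/8.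
  rw [Finset.sum_sub_distrib, ← Finset.mul_sum, ← Finset.sum_mul, ← Finset.sum_div, ← hV,
    S.sum_expectedCount ν P₀ (gaussianUnitLaw_fst _ hσ hθ) T s, uniformLaw_real_singleton hF hs,
    hdsq]
  field_simp
  norm_num

/-- A Bayes argument: once all labellings are realized, the regret splits into a sum over contexts,
and each term is bounded below by averaging over its own coordinate of the prior. -/
lemma Strategy.exists_expectedRegret_ge (hK : 2 ≤ K) (hPol : ∀ π ∈ Pol, IsPolicy π)
    (S : Strategy Ω C Pol) (ν : Measure Ω) [IsProbabilityMeasure ν] {F : Finset C}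
    (hF : F.Nonempty) (hall : ∀ g, Realizes Pol F g)
    {σ : Fin K → C → ℝ} (hσ : ∀ a, Measurable (σ a)) (hσ0 : ∀ a x, 0 < σ a x)
    {T : ℕ} (hT : 0 < T) :
    ∃ P, InModel (uniformLaw F hF) σ P ∧
      1 / 8 * (∫ x, √(F.card * ∑ a, σ a x ^ 2) ∂(uniformLaw F hF : Measure C)) ≤
        √T * S.expectedRegret ν P T := by
  have : Nontrivial (Fin K) := Fin.nontrivial_iff_two_le.2 hK
  choose other hother using fun a : Fin K => exists_ne a
  set V : F → ℝ := fun s => ∑ a, σ a s ^ 2 with hV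
  have hV0 : ∀ s, 0 < V s := fun s =>
    Finset.sum_pos (fun a _ => pow_pos (hσ0 a s) 2) Finset.univ_nonempty
  -- This value maximizes d(3/8 − d²T/(2MV)), the lower bound for the cost at `s`.
  set d : F → ℝ := fun s => 1 / 2 * √(F.card * V s / T) with hd
  let mean : (F → Fin K × Bool) → C → Fin K → ℝ := fun v x =>
    if h : x ∈ F then Pi.single (v ⟨x, h⟩).1 (signedShift (d ⟨x, h⟩) (v ⟨x, h⟩).2) else 0
  have hmean : ∀ v, Measurable (mean v) := fun v =>
    measurable_of_finite_support (F := F) fun x hx => by simp [mean, hx]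
  let law : (F → Fin K × Bool) → ProbabilityMeasure (UnitData C K) := fun v =>
    gaussianUnitLaw (uniformLaw F hF) hσ (hmean v)
  obtain ⟨v, hv⟩ := exists_sum_le_of_resample
    (W := fun s : F => fun u : Fin K × Bool => σ u.1 s ^ 2 / (2 * V s))
    (r := fun s v => d s * errorProb (S.recommendProb ν (law v) T s) (v s))
    (B := fun s => d s * (1 / 4))
    (fun s u => div_pos (pow_pos (hσ0 _ _) 2) (by linarith [hV0 s]))
    (fun s => by
      have := (hV0 s).ne'
      rw [Fintype.sum_prod_type]
      simp only [Fintype.sum_bool, ← two_mul]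
      rw [← Finset.mul_sum, ← Finset.sum_div]
      change 2 * (V s / (2 * V s)) = 1
      field_simp)
    (fun s v => by
      simp_rw [mul_left_comm _ (d s)]
      rw [← Finset.mul_sum]
      refine mul_le_mul_of_nonneg_left ?_ (by positivity)
      -- The reference experiment sets the means at `s` to zero and keeps those of `v` elsewhere, so
      -- it is common to all resampled values of coordinate `s`.
      have := S.quarter_le_sum_errorProb hPol ν hF hσ hσ0
        (θ := fun x => if x = (s : C) then 0 else mean v x)
        (Measurable.ite (measurableSet_singleton _) measurable_const (hmean v)) s.2 (by simp)
        (θ' := fun u => mean (Function.update v s u)) (fun u => hmean _) hT (V := V s)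
        (d := d s) rfl (hV0 s) rfl (fun u => by simp [mean]) (fun u x hx => by
          by_cases hxF : x ∈ F
          · have : (⟨x, hxF⟩ : F) ≠ s := fun h => hx (congrArg Subtype.val h)
            simp [mean, hxF, hx, this]
          · simp [mean, hxF])
      simpa using this)
  refine ⟨law v, inModel_uniformLaw hF hσ (hmean v), ?_⟩
  -- The comparator takes the good arm, or avoids the bad one by any other arm, of mean 0; K ≥ 2
  -- provides it.
  obtain ⟨π, hπ, hr⟩ := hall fun x =>
    if h : x ∈ F then (if (v ⟨x, h⟩).2 then (v ⟨x, h⟩).1 else other (v ⟨x, h⟩).1)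
    else Classical.arbitrary _
  have hreg := S.le_expectedRegret hF hσ (hmean v) hPol ν T hπ
  have hterm : ∀ s : F, ∑ a, (π s a - S.recommendProb ν (law v) T s a) * mean v s a =
      d s * errorProb (S.recommendProb ν (law v) T s) (v s) := by
    intro s
    rw [Finset.sum_eq_single (v s).1 (fun b _ hb => by simp [mean, hb]) (by simp), hr s s.2]
    rcases h : (v s).2 with _ | _
    · simp [mean, h, signedShift, errorProb, (hother (v s).1).symm]
      ring
    · simp [mean, h, signedShift, errorProb]
      ring
  rw [Finset.sum_congr rfl fun s _ => hterm s] at hreg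
  have hT0 : (0 : ℝ) < T := by exact_mod_cast hT
  rw [integral_uniformLaw]
  have hB : √T * ((F.card : ℝ)⁻¹ * ∑ s, d s * (1 / 4)) =
      1 / 8 * ((F.card : ℝ)⁻¹ * ∑ s : F, √(F.card * ∑ a, σ a s ^ 2)) := by
    rw [mul_left_comm, mul_left_comm (1 / 8 : ℝ)]
    congr 1
    rw [Finset.mul_sum, Finset.mul_sum]
    refine Finset.sum_congr rfl fun s _ => ?_
    have : √(T : ℝ) ≠ 0 := (Real.sqrt_pos.2 hT0).ne'
    simp only [hd, hV]
    rw [Real.sqrt_div' _ hT0.le]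
    field_simp
    ring
  rw [← hB]
  refine mul_le_mul_of_nonneg_left (le_trans ?_ hreg) (Real.sqrt_nonneg _)
  exact mul_le_mul_of_nonneg_left hv (by positivity)

end LowerBound

/-! ### Null consistency when some labelling is missing -/

section Null

variable {Ω C : Type*} [MeasurableSpace Ω] [MeasurableSpace C]
  {K : ℕ} {Pol : Set (C → Fin K → ℝ)}

/-- Under null consistency every arm is recommended with limiting probability `1 / K` in a context
where all means agree. -/
lemma Strategy.tendsto_recommendProb (hPol : ∀ π ∈ Pol, IsPolicy π)
    (S : Strategy Ω C Pol) (ν : Measure Ω) [IsProbabilityMeasure ν]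
    (P : ProbabilityMeasure (UnitData C K)) {x : C} {a : Fin K}
    (h : ∀ b, Tendsto (fun T : ℕ => |S.recommendProb ν P T x a - S.recommendProb ν P T x b|)
      atTop (𝓝 0)) :
    Tendsto (fun T : ℕ => S.recommendProb ν P T x a) atTop (𝓝 (K : ℝ)⁻¹) := by
  have hK : (K : ℝ) ≠ 0 := by
    have := a.pos
    positivity
  -- As the p_b sum to 1, p_a = (1 + ∑_b (p_a − p_b))/K.
  have hsum : Tendsto (fun T : ℕ => (K : ℝ)⁻¹ * (1 + ∑ b,
      (S.recommendProb ν P T x a - S.recommendProb ν P T x b))) atTop (𝓝 (K : ℝ)⁻¹) := by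
    have h0 := tendsto_finsetSum (Finset.univ : Finset (Fin K)) fun b _ =>
      (tendsto_zero_iff_abs_tendsto_zero _).2 (h b)
    simpa using (h0.const_add 1).const_mul (K : ℝ)⁻¹
  refine hsum.congr fun T => ?_
  rw [Finset.sum_sub_distrib, S.sum_recommendProb hPol]
  simp
  field_simp

/-- If some labelling realized on `F` can be moved out of the class by changing one label, then
null consistent strategies have regret of constant order for some element of the model. -/
lemma Strategy.exists_regret_ge_of_not_realizes [MeasurableSingletonClass C]
    [DecidableEq C] (hPol : ∀ π ∈ Pol, IsPolicy π)
    (S : Strategy Ω C Pol) (ν : Measure Ω) [IsProbabilityMeasure ν] {F : Finset C}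
    (hF : F.Nonempty) (hdet : DeterministicallyGenerated Pol F)
    {σ : Fin K → C → ℝ} (hσ : ∀ a, Measurable (σ a))
    (hnull : S.NullConsistent ν (uniformLaw F hF) σ)
    {g : C → Fin K} (hg : Realizes Pol F g) {s : C} (hs : s ∈ F) {a : Fin K}
    (hga : ¬ Realizes Pol F (Function.update g s a)) :
    ∃ P, InModel (uniformLaw F hF) σ P ∧ ∃ q : ℕ → ℝ, Tendsto q atTop (𝓝 (K : ℝ)⁻¹) ∧
      ∀ T, (F.card : ℝ)⁻¹ * q T ≤ S.expectedRegret ν P T := by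
  -- All means agree at `s`, so null consistency applies there; at the other points a deviation from
  -- `g` costs exactly its probability.
  set θ : C → Fin K → ℝ := fun x => if x ∈ F ∧ x ≠ s then Pi.single (g x) 1 else 0 with hθdef
  have hθ : Measurable θ := measurable_of_finite_support (F := F) fun x hx => by simp [θ, hx]
  set P := gaussianUnitLaw (uniformLaw F hF) hσ hθ with hP
  have hmodel : InModel (uniformLaw F hF) σ P := inModel_uniformLaw hF hσ hθ
  refine ⟨P, hmodel, fun T => S.recommendProb ν P T s a, ?_, fun T => ?_⟩
  · refine S.tendsto_recommendProb hPol ν P fun b => ?_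
    refine (ae_uniformLaw_iff hF).1 (hnull P hmodel) s hs (fun b c => ?_) a b
    rw [hP, condMean_uniformLaw hF hσ hθ hs, condMean_uniformLaw hF hσ hθ hs]
    simp [θ]
  · obtain ⟨π, hπ, hr⟩ := hg
    refine le_trans ?_ (S.le_expectedRegret hF hσ hθ hPol ν T hπ)
    rw [← hP]
    refine mul_le_mul_of_nonneg_left ?_ (by positivity)
    have hdev : ∀ t : F, Integrable (fun p : Ω × (Fin T → Obs C K) =>
        if (t : C) = s then (0 : ℝ) else 1 - S.policy T p.1 p.2 t (g t))
        (S.historyLaw ν P T T) := by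
      intro t
      by_cases hts : (t : C) = s
      · simp [hts]
      · simp only [hts, if_false]
        exact (integrable_const _).sub (S.integrable_policy hPol ν P T t (g t))
    calc S.recommendProb ν P T s a
        ≤ ∫ p, ∑ t : F, (if (t : C) = s then 0 else 1 - S.policy T p.1 p.2 t (g t))
            ∂(S.historyLaw ν P T T) :=
          integral_mono (S.integrable_policy hPol ν P T s a)
            (integrable_finsetSum _ fun t _ => hdev t) fun p =>
            apply_le_sum_deviation hdet hs hga (S.policy_mem T p.1 p.2)
      _ = ∑ t : F, ∑ b, (π t b - S.recommendProb ν P T t b) * θ t b := by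
          rw [integral_finsetSum _ fun t _ => hdev t]
          refine Finset.sum_congr rfl fun t _ => ?_
          by_cases hts : (t : C) = s
          · simp [hts, θ]
          · have hπt : π t = Pi.single (g t) 1 := hr t t.2
            simp only [hts, if_false]
            rw [integral_sub (integrable_const _) (S.integrable_policy hPol ν P T t (g t)),
              Finset.sum_eq_single (g t) (fun b _ hb => by simp [θ, hts, hb]) (by simp)]
            simp [θ, hts, hπt, Strategy.recommendProb]
      _ ≤ _ := le_rfl

end Null

/-! ### Combining the two cases -/

/-- A lower bound that holds for budgets `T ≥ 1` for some element of the model. -/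
lemma exists_remainder_of_pos {C : Type*} [MeasurableSpace C] {K : ℕ} {ζ : ProbabilityMeasure C}
    {σ : Fin K → C → ℝ} {R : ProbabilityMeasure (UnitData C K) → ℕ → ℝ} {B : ℝ} {ρ : ℕ → ℝ}
    (hρ : Tendsto ρ atTop (𝓝 0))
    (h : ∀ T, 0 < T → ∃ P, InModel ζ σ P ∧ B + ρ T ≤ √(T : ℝ) * R P T)
    (hne : ∃ P, InModel ζ σ P) :
    ∃ r : ℕ → ℝ, Tendsto r atTop (𝓝 0) ∧ ∀ T : ℕ, ((B + r T : ℝ) : EReal) ≤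
      ⨆ (P : ProbabilityMeasure (UnitData C K)) (_ : InModel ζ σ P),
        ((√(T : ℝ) * R P T : ℝ) : EReal) := by
  -- At T = 0 the scaled regret is 0, so the remainder cancels `B`; this does not affect the limit.
  refine ⟨fun T => if T = 0 then -B else ρ T, hρ.congr' ?_, fun T => ?_⟩
  · filter_upwards [eventually_ne_atTop 0] with T hT
    simp [hT]
  · rcases Nat.eq_zero_or_pos T with rfl | hT
    · obtain ⟨P, hP⟩ := hne
      exact le_iSup₂_of_le P hP (by simp)
    · obtain ⟨P, hP, hle⟩ := h T hT
      refine le_iSup₂_of_le P hP (EReal.coe_le_coe_iff.2 ?_)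
      simpa [hT.ne'] using hle

end

theorem theorem1 {d : ℕ} (𝒳 : Set (EuclideanSpace ℝ (Fin d))) (h𝒳 : 𝒳.Nonempty)
    {K : ℕ} (hK : 2 ≤ K)
    (Pol : Set (𝒳 → Fin K → ℝ)) (hPol : ∀ π ∈ Pol, IsPolicy π)
    (M : ℕ) (hM : HasNatarajanDim Pol M)
    (hdet : ∀ F : Finset 𝒳, Shatters Pol F → DeterministicallyGenerated Pol F) :
    ∃ ζ : ProbabilityMeasure 𝒳,
      ∀ σ : Fin K → 𝒳 → ℝ, (∀ a, Measurable (σ a)) → (∀ a x, 0 < σ a x) →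
        Integrable (fun x => √(M * ∑ a, σ a x ^ 2)) (ζ : Measure 𝒳) ∧
        ∀ (Ω : Type*) [MeasurableSpace Ω] (ν : Measure Ω) [IsProbabilityMeasure ν]
          (S : Strategy Ω 𝒳 Pol), S.NullConsistent ν ζ σ →
          ∃ r : ℕ → ℝ, Tendsto r atTop (𝓝 0) ∧
            ∀ T : ℕ,
              (((1 / 8) * (∫ x, √(M * ∑ a, σ a x ^ 2) ∂(ζ : Measure 𝒳)) + r T : ℝ) : EReal) ≤
                ⨆ (P : ProbabilityMeasure (UnitData 𝒳 K)) (_ : InModel ζ σ P),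
                  ((√(T : ℝ) * S.expectedRegret ν P T : ℝ) : EReal) := by
  classical
  obtain ⟨⟨F, hFM, hsh⟩, -⟩ := hM
  have hdetF := hdet F hsh
  obtain ⟨f₁, f₂, -, hsh⟩ := hsh
  rcases F.eq_empty_or_nonempty with rfl | hF
  -- No uniform law exists on the empty set. A point mass serves instead: the bound is 0, and with
  -- all means zero the regret is nonnegative.
  · obtain rfl : M = 0 := by simpa using hFM.symm
    obtain ⟨x₀⟩ := h𝒳.to_subtype
    have hF₀ : ({x₀} : Finset 𝒳).Nonempty := Finset.singleton_nonempty x₀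
    refine ⟨uniformLaw {x₀} hF₀, fun σ hσ hσ0 => ⟨integrable_uniformLaw _ _, ?_⟩⟩
    intro Ω _ ν _ S _
    have hθ : Measurable (0 : 𝒳 → Fin K → ℝ) := measurable_const
    obtain ⟨π, hπ, -⟩ := hsh fun _ => true
    refine ⟨0, tendsto_const_nhds, fun T => le_iSup₂_of_le
      (gaussianUnitLaw (uniformLaw {x₀} hF₀) hσ hθ) (inModel_uniformLaw hF₀ hσ hθ)
      (EReal.coe_le_coe_iff.2 ?_)⟩
    have := S.le_expectedRegret hF₀ hσ hθ hPol ν T hπ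
    simp only [Pi.zero_apply, mul_zero, Finset.sum_const_zero] at this
    simpa using mul_nonneg (Real.sqrt_nonneg (T : ℝ)) this
  · subst hFM
    refine ⟨uniformLaw F hF, fun σ hσ hσ0 => ⟨integrable_uniformLaw _ _, ?_⟩⟩
    intro Ω _ ν _ S hnull
    have hne : ∃ P, InModel (uniformLaw F hF) σ P :=
      ⟨_, inModel_uniformLaw hF hσ (measurable_const : Measurable (0 : 𝒳 → Fin K → ℝ))⟩
    -- The dichotomy: closed under single label changes, or not.
    by_cases hclosed : ∀ g, Realizes Pol F g → ∀ s ∈ F, ∀ a,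
        Realizes Pol F (Function.update g s a)
    · have hall := realizes_of_update_closed hclosed (g₀ := f₁) (by
        obtain ⟨π, hπ, hr⟩ := hsh fun _ => true
        exact ⟨π, hπ, by simpa using hr⟩)
      refine exists_remainder_of_pos (ρ := 0) tendsto_const_nhds (fun T hT => ?_) hne
      obtain ⟨P, hP, hle⟩ := S.exists_expectedRegret_ge hK hPol ν hF hall hσ hσ0 hT
      exact ⟨P, hP, by simpa using hle⟩
    · push Not at hclosed
      obtain ⟨g, hg, s, hs, a, hga⟩ := hclosed
      obtain ⟨P, hP, q, hq, hle⟩ :=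
        S.exists_regret_ge_of_not_realizes hPol ν hF hdetF hσ hnull hg hs hga
      set B := 1 / 8 * ∫ x, √(F.card * ∑ a, σ a x ^ 2) ∂(uniformLaw F hF : Measure 𝒳) with hB
      have hKpos : (0 : ℝ) < (K : ℝ)⁻¹ := by
        have : 0 < K := by omega
        positivity
      have hcard : (0 : ℝ) < (F.card : ℝ)⁻¹ := by
        have := hF.card_pos
        positivity
      have htop : Tendsto (fun T : ℕ => √(T : ℝ) * ((F.card : ℝ)⁻¹ * q T)) atTop atTop :=
        (Real.tendsto_sqrt_atTop.comp tendsto_natCast_atTop_atTop).atTop_mul_pos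
          (mul_pos hcard hKpos) (hq.const_mul _)
      -- The scaled regret bound diverges, so it falls short of `B` for finitely many T only; the
      -- minimum records this shortfall and is eventually 0.
      refine exists_remainder_of_pos
        (ρ := fun T => min 0 (√(T : ℝ) * ((F.card : ℝ)⁻¹ * q T) - B)) ?_ (fun T _ => ?_) hne
      · refine tendsto_const_nhds.congr' ?_
        filter_upwards [htop.eventually_ge_atTop B] with T hT
        rw [min_eq_left (by linarith)]
      · refine ⟨P, hP, ?_⟩
        have h1 := min_le_right 0 (√(T : ℝ) * ((F.card : ℝ)⁻¹ * q T) - B)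
        have h2 := mul_le_mul_of_nonneg_left (hle T) (Real.sqrt_nonneg (T : ℝ))
        linarith
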